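/- Let $d\ge 0$ be an integer. Define $\beta_d(t)=2\sin(dt/2)$ if $t\ge 0$ and $dt\le\pi$, and $\beta_d(t)=2$ if $dt>\pi$ (so $\beta_0=0$). Let $f(\zeta)=\sum_{|k|\le d}c_k\zeta^k$ be a trigonometric polynomial of degree at most $d$ with complex coefficients such that $|f(\zeta)|\le 1$ for all $\zeta$ in the unit circle $\mathbb T$. Then for every complex Hilbert space $\mathscr H$ and all unitary operators $U,V$ on $\mathscr H$ (with $f(U)=\sum_{|k|\le d} c_kU^k$): (1) $\|f(U)-f(V)\|\le d\,\|U-V\|$; (2) $\|f(U)-f(V)\|\le\beta_d\big(2\arcsin(\tfrac12\|U-V\|)\big)$; (3) $\|f(U)R-Rf(V)\|\le d\,\|UR-RV\|$ for every bounded operator $R$ on $\mathscr H$; (4) $\|f(U)R-Rf(V)\|_{\mathfrak I}\le d\,\|UR-RV\|_{\mathfrak I}$ for every bounded operator $R$ on $\mathscr H$ and every quasinormed ideal $\mathfrak I$ on $\mathscr H$ with the majorization property. Moreover, for every $\delta\in(0,2]$, $$\beta_d\big(2\arcsin(\delta/2)\big)=\sup\big\{|z^d-w^d|:\ z,w\in\mathbb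 T,\ |z-w|<\delta\big\},$$ and inequality (2) is sharp: for every $\delta\in[0,2]$ there are unitary operators $U,V$ on $\mathbb C^2$ with $\|U-V\|=\delta$ and $\|U^d-V^d\|=\beta_d\big(2\arcsin(\delta/2)\big)$, so that equality holds in (2) for $f(\zeta)=\zeta^d$. Here a quasinormed ideal $\mathfrak I$ on $\mathscr H$ is a nonzero linear subspace of the algebra $\mathscr B(\mathscr H)$ of bounded operators, equipped with a quasi-norm $\|\cdot\|_{\mathfrak I}$ that makes it a quasi-Banach space, such that $ATB\in\mathfrak I$ and $\|ATB\|_{\mathfrak I}\le\|A\|\,\|B\|\,\|T\|_{\mathfrak I}$ for all $A,B\in\mathscr B(\mathscr H)$ and $T\in\mathfrak I$; we put $\|T\|_{\mathfrak I}=\infty$ if $T\notin\mathfrak I$ (and $0\cdot\infty=0$). With the singular values $s_j(T)=\inf\{\|T-K\|:\ K\in\mathscr B(\mathscr H),\ \operatorname{rank}K\le j\}$, the ideal $\mathfrak I$ has the majorization property if $T_1\in\mathfrak I$, $T_2\in\mathscr B(\mathscr H)$ and $\sum_{j=0}^{l}s_j(T_2)\le\sum_{j=0}^{l}s_j(T_1)$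 for all $l\ge0$ imply $T_2\in\mathfrak I$ and $\|T_2\|_{\mathfrak I}\le\|T_1\|_{\mathfrak I}$. -/

import Mathlib

open scoped ENNReal Topology

universe u

noncomputable section

/-- A trigonometric polynomial `∑ cₖ ζᵏ`, given by its coefficients, has degree at most `d`
if `cₖ = 0` whenever `|k| > d`. -/
def TrigDegreeLE (f : LaurentPolynomial ℂ) (d : ℕ) : Prop :=
  ∀ k : ℤ, (d : ℤ) < |k| → f.coeff k = 0

/-- The value `f(ζ) = ∑ cₖ ζᵏ` at a point of the unit circle. -/
def trigVal (f : LaurentPolynomial ℂ) (z : Circle) : ℂ :=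
  f.smeval (Circle.toUnits z)

/-- The modulus function `β_σ(δ)`: it is `2 sin (σ δ / 2)` for `δ ≤ π / σ` and `2` for larger `δ`.
The condition is written as `σ δ ≤ π`, so that `β_0 = 0`. -/
def bernsteinBeta (σ δ : ℝ) : ℝ :=
  if σ * δ ≤ Real.pi then 2 * Real.sin (σ * δ / 2) else 2

section Operators

variable {H : Type u} [NormedAddCommGroup H] [InnerProductSpace ℂ H] [CompleteSpace H]

/-- The operator `f(U) = ∑ cₖ Uᵏ` for a unitary operator `U`. -/
def trigOp (f : LaurentPolynomial ℂ) (U : unitary (H →L[ℂ] H)) : H →L[ℂ] H :=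
  f.smeval (Unitary.toUnits U)

/-- The singular values `s_j(T) = inf {‖T - R‖ : rank R ≤ j}`, `j ≥ 0`. -/
def singVal (T : H →L[ℂ] H) (j : ℕ) : ℝ :=
  sInf {x : ℝ | ∃ R : H →L[ℂ] H,
    LinearMap.rank (R : H →ₗ[ℂ] H) ≤ (j : Cardinal) ∧ x = ‖T - R‖}

/-- The norm `∑_{j = 0}^{l} s_j(T)`. -/
def kyFanNorm (l : ℕ) (T : H →L[ℂ] H) : ℝ :=
  ∑ j ∈ Finset.range (l + 1), singVal T j

end Operators

/-- A (symmetrically) quasinormed ideal of bounded operators on `H`: a nonzero linear manifold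
with a quasi-norm that makes it a quasi-Banach space, such that `ATB` lies in it with
`‖ATB‖ ≤ ‖A‖ ‖B‖ ‖T‖` whenever `T` does. -/
structure QuasinormedIdeal (H : Type u) [NormedAddCommGroup H] [InnerProductSpace ℂ H]
    [CompleteSpace H] where
  /-- the underlying linear manifold -/
  carrier : Submodule ℂ (H →L[ℂ] H)
  carrier_ne_bot : carrier ≠ ⊥
  /-- the quasi-norm -/
  qnorm : carrier → ℝ
  qnorm_nonneg : ∀ T, 0 ≤ qnorm T
  qnorm_eq_zero_iff : ∀ T, qnorm T = 0 ↔ T = 0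
  qnorm_smul : ∀ (c : ℂ) (T : carrier), qnorm (c • T) = ‖c‖ * qnorm T
  qnorm_add_le : ∃ C : ℝ, ∀ S T : carrier, qnorm (S + T) ≤ C * (qnorm S + qnorm T)
  complete : ∀ T : ℕ → carrier,
    (∀ ε > 0, ∃ N, ∀ m ≥ N, ∀ n ≥ N, qnorm (T m - T n) < ε) →
      ∃ S : carrier, Filter.Tendsto (fun n => qnorm (T n - S)) Filter.atTop (𝓝 0)
  mul_mem : ∀ (A B T : H →L[ℂ] H), T ∈ carrier → A * T * B ∈ carrier
  qnorm_mul_le : ∀ (A B : H →L[ℂ] H) (T : carrier),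
    qnorm ⟨A * T * B, mul_mem A B T T.2⟩ ≤ ‖A‖ * ‖B‖ * qnorm T

namespace QuasinormedIdeal

variable {H : Type u} [NormedAddCommGroup H] [InnerProductSpace ℂ H] [CompleteSpace H]

open Classical in
/-- The quasi-norm of an ideal extended to all bounded operators, by `∞` outside the ideal. -/
def extNorm (I : QuasinormedIdeal H) (T : H →L[ℂ] H) : ℝ≥0∞ :=
  if h : T ∈ I.carrier then ENNReal.ofReal (I.qnorm ⟨T, h⟩) else ∞

/-- The majorization property: if `T₁` is in the ideal and every partial sum of the singular values
of a bounded operator `T₂` is at most that of `T₁`, then `T₂` is in the ideal and its quasi-norm is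
at most that of `T₁`. -/
def HasMajorization (I : QuasinormedIdeal H) : Prop :=
  ∀ (T₁ : I.carrier) (T₂ : H →L[ℂ] H),
    (∀ l : ℕ, kyFanNorm l T₂ ≤ kyFanNorm l (T₁ : H →L[ℂ] H)) →
      ∃ h : T₂ ∈ I.carrier, I.qnorm ⟨T₂, h⟩ ≤ I.qnorm T₁

end QuasinormedIdeal

end

/-! The core is a Bernstein inequality for differences: an algebra-valued trigonometric polynomial
`g` of degree at most `N`, bounded by 1, satisfies `‖g (s + τ) - g (s - τ)‖ ≤ 2 sin (N τ)` when `0 <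
N τ < π / 2`. It follows from a Riesz-type interpolation formula at the zeros of `cos (N t)`, whose
weights have absolute sum exactly `2 sin (N τ)` (`trigPoly_sub_eq_sum`,
`TrigInterp.sum_abs_weight`).

For (2), write `U V⁻¹ = exp (i A)` with `‖A‖ = θ = 2 arcsin (‖U - V‖ / 2)`. If the spectrum of `A`
lay in `η ℤ`, then `t ↦ f (exp (i t A / η) V)` would be a trigonometric polynomial of degree at most
`d θ / η`, bounded by 1, and Bernstein would give `2 sin (d θ / 2)`. In general a partition of unity
of mesh `η` in the functional calculus of `A` gives an isometry `J` into a finite direct sum, where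
a diagonal unitary with phases in `η ℤ` imitates `exp (i A)` up to `η`. The error disappears as `η →
0` with `M η = θ` fixed. Then (1) follows from `|sin (d x)| ≤ d sin x`.

For (3), `f(U) R - R f(V)` is the image of `U R - R V` under the divided difference transformer
`divDiff f U V`. Differentiating (1) along `exp (i s A) U` bounds the transformer by `d` on the
operators `i A U`, and a 2 × 2 block trick extends this to every operator (`norm_divDiff_le`).

For (4), trace duality turns the operator norm bound into a bound on finite sums of rank one
operators. Splitting `X` at a level just above `s_l` combines the two bounds into
`kyFanNorm_divDiff_le`, and majorization does the rest. Sharpness comes from 2 × 2 diagonal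
unitaries. -/

noncomputable section

/-! ### Interpolation at the zeros of `cos (N t)`. -/

namespace TrigInterp

open Complex Finset

/-- The `n`-th of the `2N` zeros of `cos (N t)` in `[0, 2π]`. -/
def node (N n : ℕ) : ℝ := (2 * n + 1) * Real.pi / (2 * N)

/-- The weights of the interpolation formula for the difference `g(τ) - g(-τ)`. -/
def weight (N : ℕ) (τ : ℝ) (n : ℕ) : ℝ :=
  (-1) ^ n * (Real.cos (N * τ) * Real.sin τ / (N * (Real.cos τ - Real.cos (node N n))))

/-- The exponential sums of the interpolation formula. -/
def moment (N : ℕ) (τ : ℝ) (k : ℤ) : ℂ :=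
  ∑ n ∈ range (2 * N), (weight N τ n : ℂ) * exp (k * node N n * I)

variable {N : ℕ} {τ : ℝ}

/-- Every node is at distance at least `π / (2 N) > τ` from `0` and `2 π`. Hence the denominators of
the weights are positive and their signs are exactly `(-1) ^ n`. -/
lemma cos_node_lt (hτ : 0 < τ) (hN : N * τ < Real.pi / 2) {n : ℕ} (hn : n < 2 * N) :
    Real.cos (node N n) < Real.cos τ := by
  have hN0 : 0 < N := by omega
  have hNr : (0 : ℝ) < N := by exact_mod_cast hN0
  have hpi := Real.pi_pos
  have hn' : (n : ℝ) + 1 ≤ 2 * N := by exact_mod_cast hn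
  have h1 : τ < node N n := by
    rw [node, lt_div_iff₀ (by positivity)]
    have : (0 : ℝ) ≤ n * Real.pi := by positivity
    nlinarith
  have h2 : τ < 2 * Real.pi - node N n := by
    rw [node, lt_sub_comm, div_lt_iff₀ (by positivity)]
    nlinarith
  rcases le_total (node N n) Real.pi with h | h
  · exact Real.cos_lt_cos_of_nonneg_of_le_pi hτ.le h h1
  · rw [← Real.cos_two_pi_sub (node N n)]
    exact Real.cos_lt_cos_of_nonneg_of_le_pi hτ.le (by linarith) h2

lemma cos_mul_pos (hτ : 0 < τ) (hN : N * τ < Real.pi / 2) : 0 < Real.cos (N * τ) :=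
  Real.cos_pos_of_mem_Ioo ⟨by have := Real.pi_pos; have : 0 ≤ N * τ := by positivity
                              linarith, hN⟩

lemma sin_pos (hN0 : 0 < N) (hτ : 0 < τ) (hN : N * τ < Real.pi / 2) : 0 < Real.sin τ := by
  have hNr : (1 : ℝ) ≤ N := by exact_mod_cast hN0
  have := Real.pi_pos
  exact Real.sin_pos_of_pos_of_lt_pi hτ (by nlinarith)

lemma abs_weight (hτ : 0 < τ) (hN : N * τ < Real.pi / 2) {n : ℕ} (hn : n < 2 * N) :
    |weight N τ n| = (-1) ^ n * weight N τ n := by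
  have hN0 : 0 < N := by omega
  have hNr : (0 : ℝ) < N := by exact_mod_cast hN0
  have h1 := cos_mul_pos hτ hN
  have h2 := sin_pos hN0 hτ hN
  have h3 := sub_pos.2 (cos_node_lt hτ hN hn)
  rw [weight, abs_mul, abs_pow, abs_neg, abs_one, one_pow, one_mul, ← mul_assoc, ← mul_pow,
    neg_one_mul, neg_neg, one_pow, one_mul, abs_of_pos (by positivity)]

lemma exp_two_mul_node (hN0 : 0 < N) (n : ℕ) : exp ((2 * N : ℤ) * node N n * I) = -1 := by
  have : ((2 * N : ℤ) : ℂ) * node N n * I = n * (2 * Real.pi * I) + Real.pi * I := by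
    have : (N : ℂ) ≠ 0 := by exact_mod_cast hN0.ne'
    simp only [node]; push_cast; field_simp
  rw [this, exp_add, exp_nat_mul_two_pi_mul_I, exp_pi_mul_I, one_mul]

lemma exp_mul_node (hN0 : 0 < N) (n : ℕ) : exp ((N : ℤ) * node N n * I) = (-1) ^ n * I := by
  have : ((N : ℤ) : ℂ) * node N n * I = n * (Real.pi * I) + Real.pi / 2 * I := by
    have : (N : ℂ) ≠ 0 := by exact_mod_cast hN0.ne'
    simp only [node]; push_cast; field_simp
  rw [this, exp_add, exp_nat_mul, exp_pi_mul_I, exp_pi_div_two_mul_I]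

/-- The reflection `n ↦ 2 N - 1 - n` sends a node `t` to `2 π - t`, and reverses the sign `(-1) ^ n`
because `2 N - 1` is odd. -/
lemma moment_neg (hN0 : 0 < N) (k : ℤ) : moment N τ (-k) = -moment N τ k := by
  rw [moment, ← sum_range_reflect, moment, ← sum_neg_distrib]
  refine sum_congr rfl fun n hn => ?_
  have hn := mem_range.1 hn
  have h1 : node N (2 * N - 1 - n) = 2 * Real.pi - node N n := by
    have : (N : ℝ) ≠ 0 := by exact_mod_cast hN0.ne'
    rw [node, node, Nat.cast_sub (by omega), Nat.cast_sub (by omega)]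
    push_cast; field_simp; ring
  have h2 : (-1 : ℝ) ^ (2 * N - 1 - n) = -(-1) ^ n := by
    have : (-1 : ℝ) ^ (2 * N - 1 - n) * (-1) ^ n = -1 := by
      rw [← pow_add, show 2 * N - 1 - n + n = 2 * (N - 1) + 1 by omega]; simp [pow_add, pow_mul]
    have h3 : ((-1 : ℝ) ^ n) * (-1) ^ n = 1 := by rw [← mul_pow]; simp
    linear_combination (-1 : ℝ) ^ n * this - (-1 : ℝ) ^ (2 * N - 1 - n) * h3
  have h3 : exp ((-k : ℤ) * ((2 * Real.pi - node N n : ℝ) : ℂ) * I) = exp (k * node N n * I) := by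
    rw [show ((-k : ℤ) : ℂ) * ((2 * Real.pi - node N n : ℝ) : ℂ) * I
      = k * node N n * I - k * (2 * Real.pi * I) by push_cast; ring, exp_sub,
      exp_int_mul_two_pi_mul_I, div_one]
  rw [weight, h1, h2, h3, Real.cos_two_pi_sub, weight]
  push_cast; ring

/-- A geometric sum whose ratio `exp (2 π i (N + k) / (2 N))` is a root of unity of order dividing
`2 N`, different from 1. -/
lemma sum_alternating_exp (k : ℤ) (hk : ¬ (2 * N : ℤ) ∣ N + k) (hN0 : 0 < N) :
    ∑ n ∈ range (2 * N), (-1 : ℂ) ^ n * exp (k * node N n * I) = 0 := by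
  have hNc : (N : ℂ) ≠ 0 := by exact_mod_cast hN0.ne'
  set r : ℂ := exp ((N + k : ℤ) / (2 * N : ℤ) * (2 * Real.pi * I)) with hr
  have hr1 : r ≠ 1 := by
    intro h
    obtain ⟨m, hm⟩ := exp_eq_one_iff.1 h
    apply hk
    have h2 : (2 * Real.pi * I : ℂ) ≠ 0 := by simp [Real.pi_ne_zero]
    have := mul_right_cancel₀ h2 hm
    push_cast at this
    field_simp at this
    exact ⟨m, by rw [mul_comm 2]; exact_mod_cast this⟩
  have hrN : r ^ (2 * N) = 1 := by
    rw [hr, ← exp_nat_mul]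
    rw [show ((2 * N : ℕ) : ℂ) * ((N + k : ℤ) / (2 * N : ℤ) * (2 * Real.pi * I))
      = (N + k : ℤ) * (2 * Real.pi * I) by push_cast; field_simp]
    exact exp_int_mul_two_pi_mul_I _
  have : ∀ n ∈ range (2 * N), (-1 : ℂ) ^ n * exp (k * node N n * I)
      = exp (k * (Real.pi / (2 * N)) * I) * r ^ n := by
    intro n _
    rw [hr, ← exp_nat_mul, ← exp_pi_mul_I, ← exp_nat_mul, ← exp_add, ← exp_add]
    congr 1
    simp only [node]; push_cast; field_simp; ring
  rw [sum_congr rfl this, ← mul_sum]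
  have := geom_sum_mul r (2 * N)
  rw [hrN, sub_self, mul_eq_zero] at this
  rw [this.resolve_right (sub_ne_zero.2 hr1), mul_zero]

/-- Since `exp (i (k + 1) t) + exp (i (k - 1) t) = 2 cos t exp (i k t)`, the left side multiplies
each weight by `2 (cos t - cos τ)`, which cancels its denominator. -/
lemma moment_recurrence (hτ : 0 < τ) (hN : N * τ < Real.pi / 2) (k : ℤ) :
    moment N τ (k + 1) + moment N τ (k - 1) - 2 * Real.cos τ * moment N τ k =
      -(2 * Real.cos (N * τ) * Real.sin τ / N) *
        ∑ n ∈ range (2 * N), (-1 : ℂ) ^ n * exp (k * node N n * I) := by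
  simp only [moment, mul_sum, ← sum_add_distrib, ← sum_sub_distrib]
  refine sum_congr rfl fun n hn => ?_
  have hn := mem_range.1 hn
  have hNc : (N : ℂ) ≠ 0 := by exact_mod_cast (show N ≠ 0 by omega)
  have h3 : (Real.cos τ : ℂ) - Real.cos (node N n) ≠ 0 := by
    rw [← ofReal_sub, ofReal_ne_zero]; exact (sub_pos.2 (cos_node_lt hτ hN hn)).ne'
  have h1 : exp ((k + 1 : ℤ) * node N n * I) + exp ((k - 1 : ℤ) * node N n * I)
      = 2 * Real.cos (node N n) * exp (k * node N n * I) := by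
    rw [ofReal_cos, two_cos, show ((k + 1 : ℤ) : ℂ) * node N n * I = k * node N n * I + node N n * I
      by push_cast; ring, show ((k - 1 : ℤ) : ℂ) * node N n * I = k * node N n * I + -node N n * I
      by push_cast; ring, exp_add, exp_add]
    ring
  rw [← mul_add, h1, weight]
  push_cast at h3 ⊢
  field_simp
  ring

lemma moment_zero (hN0 : 0 < N) : moment N τ 0 = 0 := by
  have := moment_neg (τ := τ) hN0 0
  rw [neg_zero] at this
  exact self_eq_neg.1 this

/-- For `0 < k < N` the recurrence is homogeneous; `sin (k τ)` satisfies it too and also vanishes at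
`k = 0`, so the moments are proportional to it. Two consecutive values are carried through the
induction. -/
lemma moment_eq_mul_sin (hN0 : 0 < N) (hτ : 0 < τ) (hN : N * τ < Real.pi / 2) (k : ℕ) (hk : k < N) :
    moment N τ k * Real.sin τ = moment N τ 1 * Real.sin (k * τ) ∧
    moment N τ (k + 1) * Real.sin τ = moment N τ 1 * Real.sin ((k + 1) * τ) := by
  induction k with
  | zero => simp [moment_zero hN0]
  | succ k ih =>
    obtain ⟨h1, h2⟩ := ih (by omega)
    refine ⟨by exact_mod_cast h2, ?_⟩
    have h3 := moment_recurrence hτ hN (k + 1 : ℤ)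
    rw [sum_alternating_exp _ _ hN0, mul_zero] at h3
    · rw [add_sub_cancel_right] at h3
      have h4 : Real.sin ((k + 1 + 1) * τ) + Real.sin (k * τ)
          = 2 * Real.cos τ * Real.sin ((k + 1) * τ) := by
        rw [show ((k : ℝ) + 1 + 1) * τ = (k + 1) * τ + τ by ring,
          show (k : ℝ) * τ = (k + 1) * τ - τ by ring, Real.sin_add, Real.sin_sub]; ring
      have h5 : (Real.sin ((k + 1 + 1) * τ) : ℂ) + Real.sin (k * τ)
          = 2 * Real.cos τ * Real.sin ((k + 1) * τ) := by exact_mod_cast h4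
      push_cast at h1 h2 h3 h5 ⊢
      linear_combination Complex.sin τ * h3 - h1 + 2 * Complex.cos τ * h2 - moment N τ 1 * h5
    · intro h
      have := Int.le_of_dvd (by omega) h
      omega

lemma moment_eq (hN0 : 0 < N) (hτ : 0 < τ) (hN : N * τ < Real.pi / 2) (k : ℕ) (hk : k ≤ N) :
    moment N τ k = 2 * I * Real.sin (k * τ) := by
  have hs : (Real.sin τ : ℂ) ≠ 0 := by exact_mod_cast (sin_pos hN0 hτ hN).ne'
  have hc : (Real.cos (N * τ) : ℂ) ≠ 0 := by exact_mod_cast (cos_mul_pos hτ hN).ne'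
  -- The proportionality constant is found from the recurrence at `k = N`, the first inhomogeneous
  -- one. There `exp (2 i N t) = -1` at the nodes, together with oddness, folds the moment `N + 1`
  -- back to the moment `N - 1`.
  have key : moment N τ 1 = 2 * I * Real.sin τ := by
    obtain ⟨M, rfl⟩ : ∃ M, N = M + 1 := ⟨N - 1, by omega⟩
    obtain ⟨h1, h2⟩ := moment_eq_mul_sin hN0 hτ hN M (by omega)
    have h3 := moment_recurrence hτ hN ((M + 1 : ℕ) : ℤ)
    have h4 : moment (M + 1) τ (((M + 1 : ℕ) : ℤ) + 1) = moment (M + 1) τ M := by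
      rw [← neg_neg (moment (M + 1) τ M), ← moment_neg hN0, moment, moment, ← sum_neg_distrib]
      refine sum_congr rfl fun n _ => ?_
      rw [show ((((M + 1 : ℕ) : ℤ) + 1 : ℤ) : ℂ) * node (M + 1) n * I =
        (2 * (M + 1 : ℕ) : ℤ) * node (M + 1) n * I + (-M : ℤ) * node (M + 1) n * I by
          push_cast; ring, exp_add, exp_two_mul_node hN0]
      ring
    have h5 : ∑ n ∈ range (2 * (M + 1)),
        (-1 : ℂ) ^ n * exp (((M + 1 : ℕ) : ℤ) * node (M + 1) n * I) = 2 * (M + 1) * I := by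
      rw [sum_congr rfl (fun n _ => by
        rw [exp_mul_node hN0, ← mul_assoc, ← mul_pow, neg_one_mul, neg_neg, one_pow, one_mul])]
      simp
    have hM : (M : ℂ) + 1 ≠ 0 := by exact_mod_cast hN0.ne'
    rw [h4, h5] at h3
    have h6 : Real.sin (M * τ) = Real.sin ((M + 1) * τ) * Real.cos τ
        - Real.cos ((M + 1) * τ) * Real.sin τ := by
      rw [← Real.sin_sub]; congr 1; ring
    have h7 : (Real.sin (M * τ) : ℂ) = Real.sin ((M + 1) * τ) * Real.cos τ
        - Real.cos ((M + 1) * τ) * Real.sin τ := by exact_mod_cast h6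
    push_cast at h1 h2 h3 h7 hs hc ⊢
    rw [show (M : ℤ) + 1 - 1 = M by ring] at h3
    field_simp at h3
    apply mul_left_cancel₀ (mul_ne_zero hc hs)
    linear_combination h1 - Complex.cos τ * h2 - Complex.sin τ / 2 * h3 + moment (M + 1) τ 1 * h7
  rcases hk.lt_or_eq with hk | rfl
  · apply mul_right_cancel₀ hs
    rw [(moment_eq_mul_sin hN0 hτ hN k hk).1, key]; ring
  · obtain ⟨M, rfl⟩ : ∃ M, k = M + 1 := ⟨k - 1, by omega⟩
    apply mul_right_cancel₀ hs
    have := (moment_eq_mul_sin hN0 hτ hN M (by omega)).2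
    push_cast at this key ⊢
    rw [this, key]; ring

lemma moment_eq_exp_sub_exp (hN0 : 0 < N) (hτ : 0 < τ) (hN : N * τ < Real.pi / 2) (k : ℤ)
    (hk : |k| ≤ N) : moment N τ k = exp (k * τ * I) - exp (-(k * τ * I)) := by
  have h2 : ∀ x : ℂ, exp (x * I) - exp (-(x * I)) = 2 * I * Complex.sin x := fun x => by
    have := Complex.two_sin x
    rw [← neg_mul]
    linear_combination (-I) * this + (exp (x * I) - exp (-x * I)) * I_sq
  rw [h2]
  rcases Int.eq_nat_or_neg k with ⟨n, rfl | rfl⟩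
  · rw [moment_eq hN0 hτ hN n (by simpa using hk)]; push_cast; rfl
  · rw [moment_neg hN0, moment_eq hN0 hτ hN n (by simpa using hk)]; push_cast
    rw [neg_mul, Complex.sin_neg]; ring

/-- At the nodes `exp (i N t) = (-1) ^ n i` compensates the signs of the weights, so the moment of
order `N` is `i` times this sum. -/
lemma sum_abs_weight (hN0 : 0 < N) (hτ : 0 < τ) (hN : N * τ < Real.pi / 2) :
    ∑ n ∈ range (2 * N), |weight N τ n| = 2 * Real.sin (N * τ) := by
  have h := moment_eq hN0 hτ hN N le_rfl
  rw [moment, sum_congr rfl (fun n _ => by rw [exp_mul_node hN0])] at h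
  have h2 : ∑ n ∈ range (2 * N), ((|weight N τ n| : ℝ) : ℂ) * I = 2 * I * Real.sin (N * τ) := by
    rw [← h]
    refine sum_congr rfl fun n hn => ?_
    rw [abs_weight hτ hN (mem_range.1 hn)]; push_cast; ring
  rw [← sum_mul, ← ofReal_sum] at h2
  have h3 := mul_right_cancel₀ I_ne_zero
    (h2.trans (show _ = (2 * Real.sin (N * τ) : ℂ) * I by ring))
  exact_mod_cast h3

end TrigInterp

/-! ### Bernstein's inequality for algebra-valued trigonometric polynomials. -/

section TrigPoly

open Complex Finset

variable {B : Type*} [NormedRing B] [NormedAlgebra ℂ B]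

/-- Trigonometric polynomials of degree at most `N` with coefficients in an algebra. -/
def trigPoly (B : Type*) [NormedRing B] [NormedAlgebra ℂ B] (N : ℕ) : Submodule ℂ (ℝ → B) :=
  Submodule.span ℂ {g | ∃ (k : ℤ) (b : B), |k| ≤ N ∧ g = fun t : ℝ => exp (k * t * I) • b}

lemma trigPoly_mono {M N : ℕ} (h : M ≤ N) : trigPoly B M ≤ trigPoly B N :=
  Submodule.span_mono fun _ ⟨k, b, hk, hg⟩ => ⟨k, b, hk.trans (by exact_mod_cast h), hg⟩

lemma exp_smul_mem_trigPoly {N : ℕ} (k : ℤ) (hk : |k| ≤ N) (b : B) :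
    (fun t : ℝ => exp (k * t * I) • b) ∈ trigPoly B N :=
  Submodule.subset_span ⟨k, b, hk, rfl⟩

lemma const_mem_trigPoly (N : ℕ) (b : B) : (fun _ : ℝ => b) ∈ trigPoly B N := by
  simpa using exp_smul_mem_trigPoly (N := N) 0 (by simp) b

lemma mul_mem_trigPoly {M N : ℕ} {g h : ℝ → B} (hg : g ∈ trigPoly B M) (hh : h ∈ trigPoly B N) :
    g * h ∈ trigPoly B (M + N) := by
  have : trigPoly B M * trigPoly B N ≤ trigPoly B (M + N) := by
    rw [trigPoly, trigPoly, Submodule.span_mul_span]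
    refine Submodule.span_mono ?_
    rintro _ ⟨_, ⟨k, b, hk, rfl⟩, _, ⟨l, c, hl, rfl⟩, rfl⟩
    refine ⟨k + l, b * c, (abs_add_le k l).trans (by push_cast; linarith), ?_⟩
    funext t
    simp only [Pi.mul_apply, smul_mul_smul_comm, ← exp_add]
    congr 2; push_cast; ring
  exact this (Submodule.mul_mem_mul hg hh)

lemma pow_mem_trigPoly {M : ℕ} {g : ℝ → B} (hg : g ∈ trigPoly B M) (n : ℕ) :
    g ^ n ∈ trigPoly B (n * M) := by
  induction n with
  | zero => simpa using! const_mem_trigPoly 0 (1 : B)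
  | succ n ih => rw [pow_succ, add_mul, one_mul]; exact mul_mem_trigPoly ih hg

-- By linearity it is enough to treat `exp (i k t) • b`, where the identity is the moment formula
-- multiplied by `exp (i k s)`.
open TrigInterp in
lemma trigPoly_sub_eq_sum {N : ℕ} {τ : ℝ} (hN0 : 0 < N) (hτ : 0 < τ) (hN : N * τ < Real.pi / 2)
    {g : ℝ → B} (hg : g ∈ trigPoly B N) (s : ℝ) :
    g (s + τ) - g (s - τ) = ∑ n ∈ range (2 * N), (weight N τ n : ℂ) • g (s + node N n) := by
  induction hg using Submodule.span_induction with
  | mem g hg =>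
    obtain ⟨k, b, hk, rfl⟩ := hg
    simp only [smul_smul, ← sum_smul, ← sub_smul]
    congr 1
    have : ∀ x : ℝ, exp (k * (s + x : ℝ) * I) = exp (k * s * I) * exp (k * x * I) := fun x => by
      rw [← exp_add]; congr 1; push_cast; ring
    rw [sub_eq_add_neg s, this, this, ← mul_sub]
    have h := moment_eq_exp_sub_exp hN0 hτ hN k hk
    rw [show (k : ℂ) * (-τ : ℝ) * I = -(k * τ * I) by push_cast; ring, ← h, moment, mul_sum]
    refine sum_congr rfl fun n _ => ?_
    rw [this]; ring
  | zero => simp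
  | add g h _ _ hg hh =>
    simp only [Pi.add_apply, smul_add, sum_add_distrib, ← hg, ← hh]; abel
  | smul c g _ hg =>
    simp only [Pi.smul_apply, ← smul_sub, hg, smul_sum]
    exact sum_congr rfl fun n _ => smul_comm _ _ _

/-- Bernstein's inequality for differences. -/
lemma norm_trigPoly_sub_le {N : ℕ} {τ : ℝ} (hN0 : 0 < N) (hτ : 0 < τ) (hN : N * τ < Real.pi / 2)
    {g : ℝ → B} (hg : g ∈ trigPoly B N) (hb : ∀ t, ‖g t‖ ≤ 1) (s : ℝ) :
    ‖g (s + τ) - g (s - τ)‖ ≤ 2 * Real.sin (N * τ) := by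
  rw [trigPoly_sub_eq_sum hN0 hτ hN hg, ← TrigInterp.sum_abs_weight hN0 hτ hN]
  refine (norm_sum_le _ _).trans (sum_le_sum fun n _ => ?_)
  rw [norm_smul, norm_real, Real.norm_eq_abs]
  exact mul_le_of_le_one_right (abs_nonneg _) (hb _)

end TrigPoly

/-! ### Functions of unitaries and the divided difference transformer. -/

section TrigOp

open Finset

variable {H : Type u} [NormedAddCommGroup H] [InnerProductSpace ℂ H] [CompleteSpace H]
variable {K : Type*} [NormedAddCommGroup K] [InnerProductSpace ℂ K] [CompleteSpace K]

lemma trigVal_eq_sum (f : LaurentPolynomial ℂ) (z : Circle) :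
    trigVal f z = ∑ k ∈ f.coeff.support, f.coeff k * (z : ℂ) ^ k := by
  simp [trigVal, LaurentPolynomial.smeval_eq_sum, Finsupp.sum]

lemma trigOp_eq_sum (f : LaurentPolynomial ℂ) (U : unitary (H →L[ℂ] H)) :
    trigOp f U = ∑ k ∈ f.coeff.support, f.coeff k • ((U ^ k : unitary (H →L[ℂ] H)) : H →L[ℂ] H) := by
  rw [trigOp, LaurentPolynomial.smeval_eq_sum, Finsupp.sum]
  refine sum_congr rfl fun k _ => ?_
  rw [← map_zpow]; rfl

lemma TrigDegreeLE.abs_le {f : LaurentPolynomial ℂ} {d : ℕ} (hf : TrigDegreeLE f d) {k : ℤ}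
    (hk : k ∈ f.coeff.support) : |k| ≤ d := by
  by_contra h
  exact (Finsupp.mem_support_iff.1 hk) (hf k (not_le.1 h))

lemma norm_unitary_le (U : unitary (H →L[ℂ] H)) : ‖(U : H →L[ℂ] H)‖ ≤ 1 :=
  ContinuousLinearMap.opNorm_le_bound _ zero_le_one fun x => by
    rw [one_mul, Unitary.norm_map]

lemma norm_trigOp_le_one {f : LaurentPolynomial ℂ} (hf : ∀ z : Circle, ‖trigVal f z‖ ≤ 1)
    (U : unitary (H →L[ℂ] H)) : ‖trigOp f U‖ ≤ 1 := by
  have hU : ∀ z ∈ spectrum ℂ (U : H →L[ℂ] H), z ≠ 0 := fun z hz h => by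
    have := spectrum.norm_eq_one_of_unitary U.2 hz
    simp [h] at this
  have hc : ∀ k : ℤ, ContinuousOn (fun z : ℂ => z ^ k) (spectrum ℂ (U : H →L[ℂ] H)) :=
    fun k z hz => (continuousAt_zpow₀ z k (Or.inl (hU z hz))).continuousWithinAt
  have : trigOp f U = cfc (fun z : ℂ => ∑ k ∈ f.coeff.support, f.coeff k • z ^ k)
      (U : H →L[ℂ] H) := by
    have h := cfc_sum (fun (k : ℤ) (z : ℂ) => f.coeff k • z ^ k) (U : H →L[ℂ] H) f.coeff.support
      (fun k _ => (hc k).const_smul (f.coeff k))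
    rw [sum_fn] at h
    rw [h, trigOp_eq_sum]
    refine sum_congr rfl fun k _ => ?_
    rw [cfc_smul _ _ _ (hc k)]
    have := cfc_zpow (R := ℂ) (Unitary.toUnits U) k (ha := by exact (inferInstance : IsStarNormal (U : H →L[ℂ] H)))
    rw [← map_zpow] at this
    exact congrArg _ this.symm
  rw [this]
  refine norm_cfc_le zero_le_one fun z hz => ?_
  have h1 : ‖z‖ = 1 := spectrum.norm_eq_one_of_unitary U.2 hz
  obtain ⟨w, rfl⟩ : ∃ w : Circle, (w : ℂ) = z := ⟨⟨z, mem_sphere_zero_iff_norm.2 h1⟩, rfl⟩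
  have := hf w
  rw [trigVal_eq_sum] at this
  simpa using this

/-- The action `X ↦ ∑ Uʲ X Vᵏ⁻¹⁻ʲ` of the divided difference of `ζᵏ`. -/
def monomialDivDiff (U V : unitary (H →L[ℂ] H)) (k : ℤ) : (H →L[ℂ] H) →ₗ[ℂ] (H →L[ℂ] H) :=
  ∑ j ∈ Ico 0 k, LinearMap.mulLeftRight ℂ
      (((U ^ j : unitary (H →L[ℂ] H)) : H →L[ℂ] H), ((V ^ (k - 1 - j) : unitary (H →L[ℂ] H)) : H →L[ℂ] H)) -
    ∑ j ∈ Ico k 0, LinearMap.mulLeftRight ℂ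
      (((U ^ j : unitary (H →L[ℂ] H)) : H →L[ℂ] H), ((V ^ (k - 1 - j) : unitary (H →L[ℂ] H)) : H →L[ℂ] H))

/-- The transformer `X ↦ ∬ (f(z) - f(w)) / (z - w) dE_U(z) X dE_V(w)` given by the divided
difference of a trigonometric polynomial. -/
def divDiff (f : LaurentPolynomial ℂ) (U V : unitary (H →L[ℂ] H)) :
    (H →L[ℂ] H) →ₗ[ℂ] (H →L[ℂ] H) :=
  ∑ k ∈ f.coeff.support, f.coeff k • monomialDivDiff U V k

lemma monomialDivDiff_apply (U V : unitary (H →L[ℂ] H)) (k : ℤ) (X : H →L[ℂ] H) :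
    monomialDivDiff U V k X =
      ∑ j ∈ Ico 0 k, ((U ^ j : unitary (H →L[ℂ] H)) : H →L[ℂ] H) * X *
          ((V ^ (k - 1 - j) : unitary (H →L[ℂ] H)) : H →L[ℂ] H) -
        ∑ j ∈ Ico k 0, ((U ^ j : unitary (H →L[ℂ] H)) : H →L[ℂ] H) * X *
          ((V ^ (k - 1 - j) : unitary (H →L[ℂ] H)) : H →L[ℂ] H) := by
  simp [monomialDivDiff]

lemma divDiff_apply (f : LaurentPolynomial ℂ) (U V : unitary (H →L[ℂ] H)) (X : H →L[ℂ] H) :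
    divDiff f U V X = ∑ k ∈ f.coeff.support, f.coeff k • monomialDivDiff U V k X := by
  simp [divDiff]

lemma sum_Ico_int_telescope {A : Type*} [AddCommGroup A] (F : ℤ → A) {a b : ℤ} (h : a ≤ b) :
    ∑ j ∈ Ico a b, (F (j + 1) - F j) = F b - F a := by
  induction b, h using Int.leInduction with
  | base => simp
  | succ b hb ih =>
    rw [← insert_Ico_right_eq_Ico_add_one hb, sum_insert (by simp), ih]
    abel

/-- The summand for `j` is `U ^ (j + 1) R V ^ (k - j - 1) - U ^ j R V ^ (k - j)`, so the sum
telescopes. -/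
lemma monomialDivDiff_commutator (U V : unitary (H →L[ℂ] H)) (k : ℤ) (R : H →L[ℂ] H) :
    monomialDivDiff U V k ((U : H →L[ℂ] H) * R - R * V) =
      ((U ^ k : unitary (H →L[ℂ] H)) : H →L[ℂ] H) * R - R * ((V ^ k : unitary (H →L[ℂ] H)) : _) := by
  have h : ∀ j : ℤ, ((U ^ j : unitary (H →L[ℂ] H)) : H →L[ℂ] H) * ((U : H →L[ℂ] H) * R - R * V) *
      ((V ^ (k - 1 - j) : unitary (H →L[ℂ] H)) : H →L[ℂ] H) =
      ((U ^ (j + 1) : unitary (H →L[ℂ] H)) : H →L[ℂ] H) * R *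
        ((V ^ (k - (j + 1)) : unitary (H →L[ℂ] H)) : H →L[ℂ] H) -
      ((U ^ j : unitary (H →L[ℂ] H)) : H →L[ℂ] H) * R *
        ((V ^ (k - j) : unitary (H →L[ℂ] H)) : H →L[ℂ] H) := fun j => by
    rw [zpow_add_one, show k - j = 1 + (k - 1 - j) by ring, zpow_one_add,
      show k - (j + 1) = k - 1 - j by ring]
    push_cast
    noncomm_ring
  rw [monomialDivDiff_apply]
  simp only [h]
  set F : ℤ → (H →L[ℂ] H) := fun j => ((U ^ j : unitary (H →L[ℂ] H)) : H →L[ℂ] H) * R *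
        ((V ^ (k - j) : unitary (H →L[ℂ] H)) : H →L[ℂ] H) with hF
  have h0 : F 0 = R * ((V ^ k : unitary (H →L[ℂ] H)) : _) := by simp [hF]
  have hk : F k = ((U ^ k : unitary (H →L[ℂ] H)) : H →L[ℂ] H) * R := by simp [hF]
  rw [← h0, ← hk]
  rcases le_total 0 k with hk | hk
  · rw [Ico_eq_empty_of_le hk, sum_empty, sub_zero]
    exact sum_Ico_int_telescope F hk
  · rw [Ico_eq_empty_of_le hk, sum_empty, zero_sub]
    rw [sum_Ico_int_telescope F hk, neg_sub]

/-- This reduces all commutator estimates to bounds for a linear transformer, independent of `R`. -/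
lemma divDiff_commutator (f : LaurentPolynomial ℂ) (U V : unitary (H →L[ℂ] H)) (R : H →L[ℂ] H) :
    divDiff f U V ((U : H →L[ℂ] H) * R - R * V) = trigOp f U * R - R * trigOp f V := by
  simp only [divDiff_apply, monomialDivDiff_commutator, trigOp_eq_sum, sum_mul, mul_sum, smul_sub,
    sum_sub_distrib, smul_mul_assoc, mul_smul_comm]

lemma comp_monomialDivDiff_comp {U V : unitary (H →L[ℂ] H)} {U' V' : unitary (K →L[ℂ] K)}
    {S : K →L[ℂ] H} {T : H →L[ℂ] K}
    (hS : ∀ j : ℤ, S ∘L ((U' ^ j : unitary (K →L[ℂ] K)) : K →L[ℂ] K) =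
      ((U ^ j : unitary (H →L[ℂ] H)) : H →L[ℂ] H) ∘L S)
    (hT : ∀ j : ℤ, ((V' ^ j : unitary (K →L[ℂ] K)) : K →L[ℂ] K) ∘L T =
      T ∘L ((V ^ j : unitary (H →L[ℂ] H)) : H →L[ℂ] H)) (k : ℤ) (X : K →L[ℂ] K) :
    S ∘L monomialDivDiff U' V' k X ∘L T = monomialDivDiff U V k (S ∘L X ∘L T) := by
  ext x
  have hS' := fun j y => DFunLike.congr_fun (hS j) y
  have hT' := fun j y => DFunLike.congr_fun (hT j) y
  simp only [ContinuousLinearMap.comp_apply] at hS' hT'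
  simp [monomialDivDiff_apply, hS', hT']

/-- Intertwining maps pass through the transformer; this is what extracts the corner of a block
operator. -/
lemma comp_divDiff_comp (f : LaurentPolynomial ℂ) {U V : unitary (H →L[ℂ] H)}
    {U' V' : unitary (K →L[ℂ] K)} {S : K →L[ℂ] H} {T : H →L[ℂ] K}
    (hS : ∀ j : ℤ, S ∘L ((U' ^ j : unitary (K →L[ℂ] K)) : K →L[ℂ] K) =
      ((U ^ j : unitary (H →L[ℂ] H)) : H →L[ℂ] H) ∘L S)
    (hT : ∀ j : ℤ, ((V' ^ j : unitary (K →L[ℂ] K)) : K →L[ℂ] K) ∘L T =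
      T ∘L ((V ^ j : unitary (H →L[ℂ] H)) : H →L[ℂ] H)) (X : K →L[ℂ] K) :
    S ∘L divDiff f U' V' X ∘L T = divDiff f U V (S ∘L X ∘L T) := by
  simp only [divDiff_apply, ← comp_monomialDivDiff_comp hS hT]
  ext x
  simp

lemma continuous_divDiff_left (f : LaurentPolynomial ℂ) (V : unitary (H →L[ℂ] H)) :
    Continuous fun p : unitary (H →L[ℂ] H) × (H →L[ℂ] H) => divDiff f p.1 V p.2 := by
  simp only [divDiff_apply, monomialDivDiff_apply]
  have : ∀ k : ℤ, Continuous fun p : unitary (H →L[ℂ] H) × (H →L[ℂ] H) =>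
      ((p.1 ^ k : unitary (H →L[ℂ] H)) : H →L[ℂ] H) := fun k =>
    continuous_subtype_val.comp ((continuous_zpow k).comp continuous_fst)
  refine continuous_finsetSum _ fun k _ => ?_
  have h : ∀ a b : ℤ, Continuous fun p : unitary (H →L[ℂ] H) × (H →L[ℂ] H) =>
      ∑ j ∈ Ico a b, ((p.1 ^ j : unitary (H →L[ℂ] H)) : H →L[ℂ] H) * p.2 *
        ((V ^ (k - 1 - j) : unitary (H →L[ℂ] H)) : H →L[ℂ] H) := fun a b =>
    continuous_finsetSum _ fun j _ => ((this j).mul continuous_snd).mul continuous_const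
  exact ((h 0 k).sub (h k 0)).const_smul (f.coeff k)

lemma sum_Ico_int_reflect {A : Type*} [AddCommMonoid A] (F : ℤ → A) (a b : ℤ) :
    ∑ j ∈ Ico a b, F (a + b - 1 - j) = ∑ j ∈ Ico a b, F j := by
  refine sum_nbij' (fun j => a + b - 1 - j) (fun j => a + b - 1 - j) ?_ ?_ ?_ ?_ ?_ <;>
    intro j hj <;> simp at hj ⊢ <;> omega

/-- Exchanging the two unitaries transposes the transformer, with respect to a family of
functionals `φ` under which `A X B` and `B Y A` are dual. -/
lemma divDiff_swap {E : Type*} [AddCommGroup E] [Module ℂ E] (f : LaurentPolynomial ℂ)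
    (U V : unitary (H →L[ℂ] H)) {X Y : H →L[ℂ] H} (φ ψ : (H →L[ℂ] H) →ₗ[ℂ] E)
    (h : ∀ A B : H →L[ℂ] H, φ (A * X * B) = ψ (B * Y * A)) :
    φ (divDiff f U V X) = ψ (divDiff f V U Y) := by
  simp only [divDiff_apply, monomialDivDiff_apply, map_sum, map_smul, map_sub, h]
  refine sum_congr rfl fun k _ => ?_
  have key : ∀ a b : ℤ, a + b = k → ∑ j ∈ Ico a b,
      ψ (((V ^ (k - 1 - j) : unitary (H →L[ℂ] H)) : H →L[ℂ] H) * Y *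
        ((U ^ j : unitary (H →L[ℂ] H)) : H →L[ℂ] H)) =
      ∑ j ∈ Ico a b, ψ (((V ^ j : unitary (H →L[ℂ] H)) : H →L[ℂ] H) * Y *
        ((U ^ (k - 1 - j) : unitary (H →L[ℂ] H)) : H →L[ℂ] H)) := fun a b hab => by
    rw [← sum_Ico_int_reflect]
    refine sum_congr rfl fun j _ => ?_
    rw [hab, show k - 1 - (k - 1 - j) = j by ring]
  rw [key 0 k (zero_add k), key k 0 (add_zero k)]

end TrigOp

/-! ### Finite direct sums and block diagonal unitaries. -/

section Blocks

open Finset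

variable {ι : Type*} [Fintype ι]
variable {H : Type*} [NormedAddCommGroup H] [InnerProductSpace ℂ H]
variable {G : Type*} [NormedAddCommGroup G] [InnerProductSpace ℂ G]

/-- The column operator `x ↦ (Tᵢ x)ᵢ` into a finite direct sum. -/
def stack (T : ι → G →L[ℂ] H) : G →L[ℂ] PiLp 2 (fun _ : ι => H) :=
  ((PiLp.continuousLinearEquiv 2 ℂ (fun _ : ι => H)).symm : _ →L[ℂ] _) ∘L ContinuousLinearMap.pi T

@[simp] lemma stack_apply (T : ι → G →L[ℂ] H) (x : G) (i : ι) : stack T x i = T i x := rfl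

lemma norm_stack_sq (T : ι → G →L[ℂ] H) (x : G) : ‖stack T x‖ ^ 2 = ∑ i, ‖T i x‖ ^ 2 := by
  simp [PiLp.norm_sq_eq_of_L2]

/-- The coordinate projection of a finite direct sum. -/
def blockProj (i : ι) : PiLp 2 (fun _ : ι => H) →L[ℂ] H := PiLp.proj 2 (fun _ : ι => H) i

@[simp] lemma blockProj_apply (i : ι) (x : PiLp 2 (fun _ : ι => H)) : blockProj i x = x i := rfl

/-- The coordinate inclusion of a finite direct sum. -/
def blockSingle [DecidableEq ι] (i : ι) : H →L[ℂ] PiLp 2 (fun _ : ι => H) :=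
  stack fun j => if j = i then 1 else 0

@[simp] lemma blockSingle_apply [DecidableEq ι] (i j : ι) (x : H) :
    (blockSingle i x : PiLp 2 (fun _ : ι => H)) j = if j = i then x else 0 := by
  rw [blockSingle, stack_apply]; split_ifs <;> simp

lemma norm_blockSingle_apply [DecidableEq ι] (i : ι) (x : H) :
    ‖(blockSingle i x : PiLp 2 (fun _ : ι => H))‖ = ‖x‖ := by
  rw [← sq_eq_sq₀ (norm_nonneg _) (norm_nonneg _), PiLp.norm_sq_eq_of_L2]
  simp [apply_ite]

variable [CompleteSpace H]

lemma coe_unitary_mul_inv (A : unitary (H →L[ℂ] H)) (x : H) :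
    (A : H →L[ℂ] H) (((A⁻¹ : unitary (H →L[ℂ] H)) : H →L[ℂ] H) x) = x :=
  congrArg (fun W : unitary (H →L[ℂ] H) => (W : H →L[ℂ] H) x) (mul_inv_cancel A)

lemma coe_unitary_inv_mul (A : unitary (H →L[ℂ] H)) (x : H) :
    ((A⁻¹ : unitary (H →L[ℂ] H)) : H →L[ℂ] H) ((A : H →L[ℂ] H) x) = x :=
  congrArg (fun W : unitary (H →L[ℂ] H) => (W : H →L[ℂ] H) x) (inv_mul_cancel A)

/-- Block diagonal unitary operators. -/
def diagUnitary : (ι → unitary (H →L[ℂ] H)) →*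
    unitary (PiLp 2 (fun _ : ι => H) →L[ℂ] PiLp 2 (fun _ : ι => H)) where
  toFun u := ⟨stack fun i => (u i : H →L[ℂ] H) ∘L blockProj i, by
    have hs : ∀ u : ι → unitary (H →L[ℂ] H),
        star (stack fun i => (u i : H →L[ℂ] H) ∘L blockProj i) =
          stack fun i => ((u⁻¹) i : H →L[ℂ] H) ∘L blockProj i := fun u => by
      rw [ContinuousLinearMap.star_eq_adjoint, eq_comm, ContinuousLinearMap.eq_adjoint_iff]
      intro x y
      simp only [PiLp.inner_apply]
      refine sum_congr rfl fun i _ => ?_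
      simp only [stack_apply, ContinuousLinearMap.comp_apply, blockProj_apply]
      exact ContinuousLinearMap.adjoint_inner_left _ _ _
    rw [Unitary.mem_iff, hs]
    constructor
    · ext x i; exact coe_unitary_inv_mul (u i) (x i)
    · ext x i; exact coe_unitary_mul_inv (u i) (x i)⟩
  map_one' := by ext x i; simp
  map_mul' u v := by ext x i; simp

@[simp] lemma diagUnitary_apply (u : ι → unitary (H →L[ℂ] H)) (x : PiLp 2 (fun _ : ι => H))
    (i : ι) : (diagUnitary u : PiLp 2 (fun _ : ι => H) →L[ℂ] PiLp 2 (fun _ : ι => H)) x i =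
      (u i : H →L[ℂ] H) (x i) := rfl

/-- Multiplication by a unimodular scalar. -/
def scalarUnitary : Circle →* unitary (H →L[ℂ] H) where
  toFun z := ⟨(z : ℂ) • 1, by
    have h : star (z : ℂ) * z = 1 := by
      rw [Complex.star_def, mul_comm, Complex.mul_conj, Circle.normSq_coe, Complex.ofReal_one]
    rw [Unitary.mem_iff, star_smul, star_one, smul_mul_smul_comm, smul_mul_smul_comm, one_mul, h,
      mul_comm, h, one_smul]
    exact ⟨rfl, rfl⟩⟩
  map_one' := by ext; simp
  map_mul' z w := by ext; simp [smul_smul, mul_comm]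

@[simp] lemma coe_scalarUnitary (z : Circle) :
    ((scalarUnitary z : unitary (H →L[ℂ] H)) : H →L[ℂ] H) = (z : ℂ) • 1 := rfl

end Blocks

/-! ### Approximate intertwining and unitary extension. -/

section Intertwining

open Finset

variable {H : Type*} [NormedAddCommGroup H] [InnerProductSpace ℂ H] [CompleteSpace H]
variable {K : Type*} [NormedAddCommGroup K] [InnerProductSpace ℂ K] [CompleteSpace K]

lemma norm_unitary_comp_le (A : unitary (K →L[ℂ] K)) (B : unitary (H →L[ℂ] H)) (T : H →L[ℂ] K) :
    ‖(A : K →L[ℂ] K) ∘L T ∘L (B : H →L[ℂ] H)‖ ≤ ‖T‖ :=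
  ContinuousLinearMap.opNorm_le_bound _ (norm_nonneg _) fun x => by
    rw [ContinuousLinearMap.comp_apply, Unitary.norm_map, ContinuousLinearMap.comp_apply]
    refine (T.le_opNorm _).trans_eq ?_
    rw [Unitary.norm_map]

lemma norm_pow_comp_sub_comp_pow_le (A : unitary (K →L[ℂ] K)) (B : unitary (H →L[ℂ] H))
    (J : H →L[ℂ] K) (n : ℕ) :
    ‖((A ^ n : unitary (K →L[ℂ] K)) : K →L[ℂ] K) ∘L J -
      J ∘L ((B ^ n : unitary (H →L[ℂ] H)) : H →L[ℂ] H)‖ ≤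
      n * ‖(A : K →L[ℂ] K) ∘L J - J ∘L (B : H →L[ℂ] H)‖ := by
  induction n with
  | zero => simp [ContinuousLinearMap.one_def]
  | succ n ih =>
    have : ((A ^ (n + 1) : unitary (K →L[ℂ] K)) : K →L[ℂ] K) ∘L J -
        J ∘L ((B ^ (n + 1) : unitary (H →L[ℂ] H)) : H →L[ℂ] H) =
        (A : K →L[ℂ] K) ∘L (((A ^ n : unitary (K →L[ℂ] K)) : K →L[ℂ] K) ∘L J -
          J ∘L ((B ^ n : unitary (H →L[ℂ] H)) : H →L[ℂ] H)) ∘L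
            ((1 : unitary (H →L[ℂ] H)) : H →L[ℂ] H) +
        ((1 : unitary (K →L[ℂ] K)) : K →L[ℂ] K) ∘L ((A : K →L[ℂ] K) ∘L J - J ∘L (B : H →L[ℂ] H)) ∘L
          ((B ^ n : unitary (H →L[ℂ] H)) : H →L[ℂ] H) := by
      ext x
      simp [pow_succ']
    rw [this]
    refine (norm_add_le _ _).trans ?_
    have h1 := norm_unitary_comp_le A 1 (((A ^ n : unitary (K →L[ℂ] K)) : K →L[ℂ] K) ∘L J -
          J ∘L ((B ^ n : unitary (H →L[ℂ] H)) : H →L[ℂ] H))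
    have h2 := norm_unitary_comp_le 1 (B ^ n) ((A : K →L[ℂ] K) ∘L J - J ∘L (B : H →L[ℂ] H))
    push_cast
    push_cast at h1 h2 ih
    linarith

lemma norm_zpow_comp_sub_comp_zpow_le (A : unitary (K →L[ℂ] K)) (B : unitary (H →L[ℂ] H))
    (J : H →L[ℂ] K) (k : ℤ) :
    ‖((A ^ k : unitary (K →L[ℂ] K)) : K →L[ℂ] K) ∘L J -
      J ∘L ((B ^ k : unitary (H →L[ℂ] H)) : H →L[ℂ] H)‖ ≤
      |(k : ℝ)| * ‖(A : K →L[ℂ] K) ∘L J - J ∘L (B : H →L[ℂ] H)‖ := by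
  rcases Int.eq_nat_or_neg k with ⟨n, rfl | rfl⟩
  · simpa using norm_pow_comp_sub_comp_pow_le A B J n
  · have h := norm_pow_comp_sub_comp_pow_le A B J n
    have h2 := norm_unitary_comp_le (A ^ n)⁻¹ (B ^ n)⁻¹
      (((A ^ n : unitary (K →L[ℂ] K)) : K →L[ℂ] K) ∘L J -
        J ∘L ((B ^ n : unitary (H →L[ℂ] H)) : H →L[ℂ] H))
    have h3 : (((A ^ n)⁻¹ : unitary (K →L[ℂ] K)) : K →L[ℂ] K) ∘L
        (((A ^ n : unitary (K →L[ℂ] K)) : K →L[ℂ] K) ∘L J -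
        J ∘L ((B ^ n : unitary (H →L[ℂ] H)) : H →L[ℂ] H)) ∘L
        (((B ^ n)⁻¹ : unitary (H →L[ℂ] H)) : H →L[ℂ] H) =
        -((((A ^ n)⁻¹ : unitary (K →L[ℂ] K)) : K →L[ℂ] K) ∘L J -
          J ∘L (((B ^ n)⁻¹ : unitary (H →L[ℂ] H)) : H →L[ℂ] H)) := by
      ext x
      simp only [ContinuousLinearMap.comp_apply, _root_.sub_apply, map_sub, coe_unitary_mul_inv, coe_unitary_inv_mul, neg_sub]
    rw [h3, norm_neg] at h2
    simpa using h2.trans h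

/-- If `J` almost intertwines `A` and `B`, it almost intertwines `f(A)` and `f(B)`. The constant is
crude and depends on `f`, which is harmless because the defect is sent to zero. -/
lemma norm_trigOp_comp_sub_le (f : LaurentPolynomial ℂ) (A : unitary (K →L[ℂ] K))
    (B : unitary (H →L[ℂ] H)) (J : H →L[ℂ] K) :
    ‖trigOp f A ∘L J - J ∘L trigOp f B‖ ≤
      (∑ k ∈ f.coeff.support, ‖f.coeff k‖ * |(k : ℝ)|) *
        ‖(A : K →L[ℂ] K) ∘L J - J ∘L (B : H →L[ℂ] H)‖ := by
  have : trigOp f A ∘L J - J ∘L trigOp f B = ∑ k ∈ f.coeff.support, f.coeff k •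
      (((A ^ k : unitary (K →L[ℂ] K)) : K →L[ℂ] K) ∘L J -
        J ∘L ((B ^ k : unitary (H →L[ℂ] H)) : H →L[ℂ] H)) := by
    ext x
    simp [trigOp_eq_sum, smul_sub]
  rw [this, sum_mul]
  refine (norm_sum_le _ _).trans (sum_le_sum fun k _ => ?_)
  rw [norm_smul, mul_assoc]
  exact mul_le_mul_of_nonneg_left (norm_zpow_comp_sub_comp_zpow_le A B J k) (norm_nonneg _)

/-- The unitary operator that acts as `V` on the range of the isometry `J` and as the identity
on its orthogonal complement. -/
lemma exists_unitary_extension (J : H →L[ℂ] K) (hJ : ∀ x, ‖J x‖ = ‖x‖) (V : unitary (H →L[ℂ] H)) :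
    ∃ W : unitary (K →L[ℂ] K), (W : K →L[ℂ] K) ∘L J = J ∘L (V : H →L[ℂ] H) := by
  have hJ' : ∀ x, J.adjoint (J x) = x := fun x =>
    DFunLike.congr_fun ((ContinuousLinearMap.norm_map_iff_adjoint_comp_self J).1 hJ) x
  -- `E` is multiplicative because `J* J = 1`, so it carries inverses to inverses.
  let E : unitary (H →L[ℂ] H) → (K →L[ℂ] K) := fun V =>
    J ∘L (V : H →L[ℂ] H) ∘L J.adjoint + (1 - J ∘L J.adjoint)
  have hs : ∀ V, star (E V) = E V⁻¹ := fun V => by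
    have h1 : star (J ∘L J.adjoint) = J ∘L J.adjoint := by
      rw [ContinuousLinearMap.star_eq_adjoint, ContinuousLinearMap.adjoint_comp,
        ContinuousLinearMap.adjoint_adjoint]
    have h2 : star (J ∘L (V : H →L[ℂ] H) ∘L J.adjoint) =
        J ∘L ((V⁻¹ : unitary (H →L[ℂ] H)) : H →L[ℂ] H) ∘L J.adjoint := by
      rw [ContinuousLinearMap.star_eq_adjoint, ContinuousLinearMap.adjoint_comp,
        ContinuousLinearMap.adjoint_comp, ContinuousLinearMap.adjoint_adjoint]
      rfl
    simp only [E, star_add, star_sub, star_one, h1, h2]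
  have hm : ∀ V W, E V * E W = E (V * W) := fun V W => by
    ext x
    simp [E, hJ']
  have h1 : E 1 = 1 := by ext x; simp [E]
  refine ⟨⟨E V, ?_⟩, ?_⟩
  · rw [Unitary.mem_iff, hs, hm, hm]; simp [h1]
  · ext x; simp [E, hJ']

end Intertwining

/-! ### Estimate through a diagonal dilation with integer frequencies. -/

section Dilation

open Finset Complex

variable {ι : Type*} [Fintype ι]
variable {H : Type*} [NormedAddCommGroup H] [InnerProductSpace ℂ H] [CompleteSpace H]

/-- The diagonal one-parameter group with integer frequencies. -/
def phaseUnitary (H : Type*) [NormedAddCommGroup H] [InnerProductSpace ℂ H] [CompleteSpace H]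
    (m : ι → ℤ) (t : ℝ) :
    unitary (PiLp 2 (fun _ : ι => H) →L[ℂ] PiLp 2 (fun _ : ι => H)) :=
  diagUnitary fun i => scalarUnitary (Circle.exp (m i * t))

lemma phaseUnitary_apply (m : ι → ℤ) (t : ℝ) (x : PiLp 2 (fun _ : ι => H)) (i : ι) :
    (phaseUnitary H m t : PiLp 2 (fun _ : ι => H) →L[ℂ] PiLp 2 (fun _ : ι => H)) x i =
      exp (m i * t * I) • x i := by
  change ((Circle.exp (m i * t) : Circle) : ℂ) • x i = _
  rw [Circle.coe_exp]; push_cast; rfl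

lemma phaseUnitary_inv (m : ι → ℤ) (t : ℝ) : (phaseUnitary H m t)⁻¹ = phaseUnitary H m (-t) := by
  rw [phaseUnitary, phaseUnitary, ← map_inv]
  congr 1
  funext i
  rw [Pi.inv_apply, ← map_inv, ← Circle.exp_neg, mul_neg]

lemma phaseUnitary_zero (m : ι → ℤ) : phaseUnitary H m 0 = 1 := by
  rw [phaseUnitary, ← map_one diagUnitary]
  congr 1
  funext i
  simp

lemma phaseUnitary_mem_trigPoly {m : ι → ℤ} {M : ℕ} (hm : ∀ i, |m i| ≤ M) :
    (fun t => (phaseUnitary H m t : PiLp 2 (fun _ : ι => H) →L[ℂ] PiLp 2 (fun _ : ι => H))) ∈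
      trigPoly _ M := by
  classical
  have : (fun t => (phaseUnitary H m t : PiLp 2 (fun _ : ι => H) →L[ℂ] PiLp 2 (fun _ : ι => H))) =
      ∑ i, fun t : ℝ => exp (m i * t * I) • (blockSingle i ∘L blockProj i) := by
    funext t
    ext x j
    rw [Finset.sum_apply, _root_.sum_apply]
    rw [show (∑ i, (exp (m i * t * I) • (blockSingle i ∘L blockProj i :
      PiLp 2 (fun _ : ι => H) →L[ℂ] PiLp 2 (fun _ : ι => H))) x) j =
        blockProj j (∑ i, (exp (m i * t * I) • (blockSingle i ∘L blockProj i :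
      PiLp 2 (fun _ : ι => H) →L[ℂ] PiLp 2 (fun _ : ι => H))) x) from rfl, map_sum]
    simp [phaseUnitary_apply]
  rw [this]
  exact Submodule.sum_mem _ fun i _ => exp_smul_mem_trigPoly _ (hm i) _

/-- Each factor `phaseUnitary H m t * W`, and likewise its inverse, has degree at most `M` in `t`,
and at most `d` such factors are multiplied. -/
lemma trigOp_phaseUnitary_mul_mem_trigPoly {f : LaurentPolynomial ℂ} {d : ℕ}
    (hf : TrigDegreeLE f d) {m : ι → ℤ} {M : ℕ} (hm : ∀ i, |m i| ≤ M)
    (W : unitary (PiLp 2 (fun _ : ι => H) →L[ℂ] PiLp 2 (fun _ : ι => H))) :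
    (fun t => trigOp f (phaseUnitary H m t * W)) ∈ trigPoly _ (d * M) := by
  have h1 : (fun t => ((phaseUnitary H m t * W : unitary _) :
      PiLp 2 (fun _ : ι => H) →L[ℂ] PiLp 2 (fun _ : ι => H))) ∈ trigPoly _ M := by
    simpa using! mul_mem_trigPoly (phaseUnitary_mem_trigPoly hm)
      (const_mem_trigPoly 0 (W : PiLp 2 (fun _ : ι => H) →L[ℂ] PiLp 2 (fun _ : ι => H)))
  have h2 : (fun t => (((phaseUnitary H m t * W)⁻¹ : unitary _) :
      PiLp 2 (fun _ : ι => H) →L[ℂ] PiLp 2 (fun _ : ι => H))) ∈ trigPoly _ M := by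
    have hneg : ∀ i, |(-m i)| ≤ (M : ℤ) := fun i => by rw [abs_neg]; exact hm i
    have h3 : ∀ t, (phaseUnitary H m t * W)⁻¹ = W⁻¹ * phaseUnitary H (fun i => -m i) t := fun t => by
      rw [mul_inv_rev, phaseUnitary_inv]
      simp [phaseUnitary]
    simp only [h3]
    simpa using! mul_mem_trigPoly (const_mem_trigPoly 0
      ((W⁻¹ : unitary _) : PiLp 2 (fun _ : ι => H) →L[ℂ] PiLp 2 (fun _ : ι => H)))
      (phaseUnitary_mem_trigPoly hneg)
  have h3 : (fun t => trigOp f (phaseUnitary H m t * W)) = ∑ k ∈ f.coeff.support, f.coeff k •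
      (fun t => (((phaseUnitary H m t * W) ^ k : unitary _) :
        PiLp 2 (fun _ : ι => H) →L[ℂ] PiLp 2 (fun _ : ι => H))) := by
    funext t
    rw [trigOp_eq_sum, Finset.sum_apply]
    rfl
  rw [h3]
  refine Submodule.sum_mem _ fun k hk => Submodule.smul_mem _ _ ?_
  have hkd := hf.abs_le hk
  rcases Int.eq_nat_or_neg k with ⟨n, rfl | rfl⟩
  · refine trigPoly_mono (Nat.mul_le_mul_right M (by simpa using hkd)) ?_
    simpa using! pow_mem_trigPoly h1 n
  · refine trigPoly_mono (Nat.mul_le_mul_right M (show n ≤ d by simpa using hkd)) ?_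
    have := pow_mem_trigPoly h2 n
    convert! this using 2 with t
    rw [zpow_neg, zpow_natCast, ← inv_pow]
    rfl

/-- The Bernstein type estimate for two unitaries whose quotient is approximated, through an
isometry into a finite direct sum, by a diagonal unitary with phases in `η ℤ`. -/
lemma norm_trigOp_sub_le_of_dilation {f : LaurentPolynomial ℂ} {d : ℕ} (hf : TrigDegreeLE f d)
    (hf1 : ∀ z : Circle, ‖trigVal f z‖ ≤ 1) (hd : 0 < d) {M : ℕ} (hM : 0 < M) {η : ℝ} (hη : 0 < η)
    (hdη : d * (M * η) < Real.pi) {m : ι → ℤ} (hm : ∀ i, |m i| ≤ M)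
    (U V : unitary (H →L[ℂ] H)) (G : ι → H →L[ℂ] H) (hG : ∀ x, ∑ i, ‖G i x‖ ^ 2 = ‖x‖ ^ 2)
    (hGD : ∀ x, ∑ i, ‖exp (m i * η * I) • G i x -
      G i (((U * V⁻¹ : unitary (H →L[ℂ] H)) : H →L[ℂ] H) x)‖ ^ 2 ≤ (η * ‖x‖) ^ 2) :
    ‖trigOp f U - trigOp f V‖ ≤ 2 * Real.sin (d * (M * η) / 2) +
      (∑ k ∈ f.coeff.support, ‖f.coeff k‖ * |(k : ℝ)|) * η := by
  set J : H →L[ℂ] PiLp 2 (fun _ : ι => H) := stack G with hJdef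
  have hJ : ∀ x, ‖J x‖ = ‖x‖ := fun x => by
    rw [← sq_eq_sq₀ (norm_nonneg _) (norm_nonneg _), norm_stack_sq, hG]
  obtain ⟨W, hW⟩ := exists_unitary_extension J hJ V
  have hWx : ∀ x, (W : PiLp 2 (fun _ : ι => H) →L[ℂ] PiLp 2 (fun _ : ι => H)) (J x) =
      J ((V : H →L[ℂ] H) x) := fun x => DFunLike.congr_fun hW x
  -- Since `W J = J V` and the phases imitate `U V⁻¹` through `J`, the operator `A J` is close to `J
  -- U`.
  set A := phaseUnitary H m η * W with hA
  have hAU : ‖(A : PiLp 2 (fun _ : ι => H) →L[ℂ] PiLp 2 (fun _ : ι => H)) ∘L J -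
      J ∘L (U : H →L[ℂ] H)‖ ≤ η := by
    refine ContinuousLinearMap.opNorm_le_bound _ hη.le fun x => ?_
    refine le_of_sq_le_sq ?_ (by positivity)
    rw [PiLp.norm_sq_eq_of_L2]
    have := hGD ((V : H →L[ℂ] H) x)
    rw [Unitary.norm_map] at this
    refine le_trans (le_of_eq ?_) this
    refine sum_congr rfl fun i _ => ?_
    rw [hA]
    simp only [Submonoid.coe_mul, mul_apply_eq_comp, ContinuousLinearMap.comp_apply,
      _root_.sub_apply, PiLp.sub_apply, phaseUnitary_apply, hWx, coe_unitary_inv_mul]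
    rfl
  have h1 := norm_trigOp_comp_sub_le f A U J
  have h2 := norm_trigOp_comp_sub_le f W V J
  rw [hW, sub_self, norm_zero, mul_zero] at h2
  have h2' := sub_eq_zero.1 (norm_le_zero_iff.1 h2)
  have hsin : d * M * (η / 2) = d * (M * η) / 2 := by ring
  -- Centre `η / 2` and half-step `η / 2` make the endpoints `η` and `0`, that is, `A` and `W`.
  have h3 := norm_trigPoly_sub_le (N := d * M) (τ := η / 2) (Nat.mul_pos hd hM) (by positivity)
    (by push_cast; rw [hsin]; linarith)
    (trigOp_phaseUnitary_mul_mem_trigPoly hf hm W) (fun t => norm_trigOp_le_one hf1 _) (η / 2)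
  simp only [add_halves, sub_self, phaseUnitary_zero, one_mul] at h3
  push_cast at h3
  rw [hsin, ← hA] at h3
  have hC : 0 ≤ ∑ k ∈ f.coeff.support, ‖f.coeff k‖ * |(k : ℝ)| :=
    sum_nonneg fun _ _ => by positivity
  have h0 : 0 ≤ 2 * Real.sin (d * (M * η) / 2) := (norm_nonneg _).trans h3
  refine ContinuousLinearMap.opNorm_le_bound _ (by positivity) fun x => ?_
  have h4 : J ((trigOp f U - trigOp f V) x) =
      (trigOp f A - trigOp f W) (J x) - (trigOp f A ∘L J - J ∘L trigOp f U) x := by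
    have := DFunLike.congr_fun h2' x
    simp only [ContinuousLinearMap.comp_apply] at this
    simp [this]
  rw [← hJ, h4, add_mul]
  refine (norm_sub_le _ _).trans (add_le_add ?_ ?_)
  · rw [← hJ x]
    exact (ContinuousLinearMap.le_opNorm _ _).trans (mul_le_mul_of_nonneg_right h3 (norm_nonneg _))
  · refine (ContinuousLinearMap.le_opNorm _ _).trans (mul_le_mul_of_nonneg_right ?_ (norm_nonneg _))
    exact h1.trans (mul_le_mul_of_nonneg_left hAU hC)

end Dilation

/-! ### A piecewise linear partition of unity. -/

section HatPartition

open Finset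

/-- The piecewise linear hat function supported in `[-1, 1]`. -/
def hat (y : ℝ) : ℝ := max 0 (1 - |y|)

lemma hat_nonneg (y : ℝ) : 0 ≤ hat y := le_max_left _ _

lemma hat_eq_zero {y : ℝ} (h : 1 ≤ |y|) : hat y = 0 := max_eq_left (by linarith)

lemma continuous_hat : Continuous hat := by unfold hat; fun_prop

lemma sum_hat_sub_eq_one {M : ℕ} {y : ℝ} (hy : |y| ≤ M) :
    ∑ m ∈ Icc (-M : ℤ) M, hat (y - m) = 1 := by
  obtain ⟨hy1, hy2⟩ := abs_le.1 hy
  -- The index `M + 1` is added so that `⌊y⌋ + 1` stays in range even when `y = M`; its hat vanishes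
  -- there.
  have h1 : ∑ m ∈ Icc (-M : ℤ) M, hat (y - m) = ∑ m ∈ Icc (-M : ℤ) (M + 1), hat (y - m) := by
    refine sum_subset (Icc_subset_Icc_right (by omega)) fun m hm hm' => hat_eq_zero ?_
    simp only [mem_Icc] at hm hm'
    obtain rfl : m = M + 1 := by omega
    push_cast
    rw [abs_sub_comm]
    exact (show (1 : ℝ) ≤ M + 1 - y by linarith).trans (le_abs_self _)
  have h2 : ∑ m ∈ ({⌊y⌋, ⌊y⌋ + 1} : Finset ℤ), hat (y - m) =
      ∑ m ∈ Icc (-M : ℤ) (M + 1), hat (y - m) := by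
    refine sum_subset ?_ fun m _ hm' => hat_eq_zero ?_
    · have h3 : -(M : ℤ) ≤ ⌊y⌋ := Int.le_floor.2 (by push_cast; linarith)
      have h4 : ⌊y⌋ ≤ M := by
        have := Int.floor_le y
        exact_mod_cast this.trans hy2
      intro m hm
      simp only [mem_insert, mem_singleton] at hm
      simp only [mem_Icc]
      omega
    · simp only [mem_insert, mem_singleton, not_or] at hm'
      have h5 := Int.floor_le y
      have h6 := Int.lt_floor_add_one y
      rcases lt_or_ge m ⌊y⌋ with h | h
      · have : (m : ℝ) + 1 ≤ ⌊y⌋ := by exact_mod_cast h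
        exact (show (1 : ℝ) ≤ y - m by linarith).trans (le_abs_self _)
      · have : (⌊y⌋ : ℝ) + 2 ≤ m := by
          have : ⌊y⌋ + 2 ≤ m := by omega
          exact_mod_cast this
        rw [abs_sub_comm]
        exact (show (1 : ℝ) ≤ m - y by linarith).trans (le_abs_self _)
  rw [h1, ← h2, sum_pair (by omega), hat, hat]
  have h5 := Int.floor_le y
  have h6 := Int.lt_floor_add_one y
  push_cast
  rw [abs_of_nonneg (by linarith), abs_of_neg (by linarith), max_eq_right (by linarith),
    max_eq_right (by linarith)]
  ring

end HatPartition

/-! ### Discretization of the generator by functional calculus. -/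

section FunctionalCalculus

open Finset Complex

variable {H : Type*} [NormedAddCommGroup H] [InnerProductSpace ℂ H] [CompleteSpace H]

lemma sum_norm_cfc_apply_sq {ι : Type*} (s : Finset ι) {a : H →L[ℂ] H} [IsStarNormal a]
    {g : ι → ℂ → ℂ} (hg : ∀ i, ContinuousOn (g i) (spectrum ℂ a)) (x : H) :
    ∑ i ∈ s, ‖cfc (g i) a x‖ ^ 2 =
      (inner ℂ (cfc (fun z => ∑ i ∈ s, star (g i z) * g i z) a x) x).re := by
  have h := cfc_sum (fun i z => star (g i z) * g i z) a s (fun i _ => ((hg i).star).mul (hg i))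
  rw [sum_fn] at h
  rw [h, _root_.sum_apply, sum_inner, re_sum]
  refine sum_congr rfl fun i _ => ?_
  rw [cfc_mul _ _ a (hg i).star (hg i), cfc_star, ContinuousLinearMap.star_eq_adjoint,
    ContinuousLinearMap.apply_norm_sq_eq_inner_adjoint_left]
  rfl

lemma sum_norm_cfc_apply_sq_le {ι : Type*} (s : Finset ι) {a : H →L[ℂ] H} [IsStarNormal a]
    {g : ι → ℂ → ℂ} (hg : ∀ i, ContinuousOn (g i) (spectrum ℂ a)) {c : ℝ} (hc : 0 ≤ c)
    (h : ∀ z ∈ spectrum ℂ a, ∑ i ∈ s, ‖g i z‖ ^ 2 ≤ c) (x : H) :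
    ∑ i ∈ s, ‖cfc (g i) a x‖ ^ 2 ≤ c * ‖x‖ ^ 2 := by
  rw [sum_norm_cfc_apply_sq s hg]
  refine (re_le_norm _).trans ((norm_inner_le_norm _ _).trans ?_)
  rw [pow_two, ← mul_assoc]
  refine mul_le_mul_of_nonneg_right ((ContinuousLinearMap.le_opNorm _ _).trans ?_) (norm_nonneg _)
  refine mul_le_mul_of_nonneg_right (norm_cfc_le hc fun z hz => ?_) (norm_nonneg _)
  refine (norm_sum_le _ _).trans ((sum_le_sum fun i _ => ?_).trans (h z hz))
  rw [norm_mul, norm_star, pow_two]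

/-- Produces the data of the dilation: the components of the isometry are functions of `A` localized
near the points `m η`. -/
lemma norm_trigOp_sub_le_of_expUnitary {f : LaurentPolynomial ℂ} {d : ℕ} (hf : TrigDegreeLE f d)
    (hf1 : ∀ z : Circle, ‖trigVal f z‖ ≤ 1) (hd : 0 < d) {M : ℕ} (hM : 0 < M) {η : ℝ} (hη : 0 < η)
    (hdη : d * (M * η) < Real.pi) (U V : unitary (H →L[ℂ] H)) (A : selfAdjoint (H →L[ℂ] H))
    (hA : ‖A‖ ≤ M * η) (hUV : U * V⁻¹ = selfAdjoint.expUnitary A) :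
    ‖trigOp f U - trigOp f V‖ ≤ 2 * Real.sin (d * (M * η) / 2) +
      (∑ k ∈ f.coeff.support, ‖f.coeff k‖ * |(k : ℝ)|) * η := by
  have hN : IsStarNormal (A : H →L[ℂ] H) := A.2.isStarNormal
  have hUV' : ((U * V⁻¹ : unitary (H →L[ℂ] H)) : H →L[ℂ] H) =
      cfc (fun z : ℂ => exp (I * z)) (A : H →L[ℂ] H) := by
    rw [hUV, selfAdjoint.expUnitary_coe, ← CFC.exp_eq_normedSpace_exp (𝕜 := ℂ),
      ← cfc_comp_smul I _ (A : H →L[ℂ] H)]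
    simp [← exp_eq_exp_ℂ]
  have hspec : ∀ z ∈ spectrum ℂ (A : H →L[ℂ] H), ∃ y : ℝ, z = y ∧ |y / η| ≤ M := fun z hz => by
    rw [← A.2.spectrumRestricts.algebraMap_image] at hz
    obtain ⟨y, hy, rfl⟩ := hz
    refine ⟨y, rfl, ?_⟩
    rw [abs_div, abs_of_pos hη, div_le_iff₀ hη]
    rcases subsingleton_or_nontrivial H with hs | hs
    · exact absurd hy (by simp [spectrum.of_subsingleton])
    · exact (spectrum.norm_le_norm_of_mem hy).trans hA
  -- Square roots of the hats are used so that the squares sum to 1 on the spectrum, which makes the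
  -- column of the `g m` applied to `A` an isometry.
  let g : Icc (-M : ℤ) M → ℂ → ℂ := fun m z => (Real.sqrt (hat (z.re / η - (m : ℤ))) : ℂ)
  have hgc : ∀ m, Continuous (g m) := fun m => by
    have := continuous_hat
    simp only [g]
    fun_prop
  have hgn : ∀ m z, ‖g m z‖ ^ 2 = hat (z.re / η - (m : ℤ)) := fun m z => by
    simp only [g]
    rw [norm_real, Real.norm_eq_abs, sq_abs, Real.sq_sqrt (hat_nonneg _)]
  have hgs : ∀ z ∈ spectrum ℂ (A : H →L[ℂ] H), ∑ m, ‖g m z‖ ^ 2 = 1 := fun z hz => by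
    obtain ⟨y, rfl, hy⟩ := hspec z hz
    simp only [hgn, ofReal_re]
    rw [Finset.sum_coe_sort (Icc (-M : ℤ) M) (fun m => hat (y / η - m))]
    exact sum_hat_sub_eq_one hy
  refine norm_trigOp_sub_le_of_dilation hf hf1 hd hM hη hdη (m := fun m : Icc (-M : ℤ) M => (m : ℤ))
    (fun m => abs_le.2 (mem_Icc.1 m.2)) U V (fun m => cfc (g m) (A : H →L[ℂ] H)) (fun x => ?_)
    (fun x => ?_)
  · rw [sum_norm_cfc_apply_sq univ (fun m => (hgc m).continuousOn)]
    have : cfc (fun z => ∑ m, star (g m z) * g m z) (A : H →L[ℂ] H) = 1 := by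
      rw [← cfc_one ℂ (A : H →L[ℂ] H)]
      refine cfc_congr fun z hz => ?_
      have := hgs z hz
      have h2 : ∀ m, star (g m z) * g m z = ((‖g m z‖ ^ 2 : ℝ) : ℂ) := fun m => by
        rw [star_def, conj_mul', ofReal_pow]
      simp only [h2]
      rw [← ofReal_sum, this]; simp
    rw [this, one_apply_eq_self, inner_self_eq_norm_sq_to_K]
    norm_cast
  · have hD : ∀ m : Icc (-M : ℤ) M, exp (((m : ℤ) : ℂ) * η * I) • cfc (g m) (A : H →L[ℂ] H) x -
        cfc (g m) (A : H →L[ℂ] H) (((U * V⁻¹ : unitary (H →L[ℂ] H)) : H →L[ℂ] H) x) =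
        cfc (fun z : ℂ => exp (((m : ℤ) : ℂ) * η * I) • g m z - g m z * exp (I * z))
          (A : H →L[ℂ] H) x := fun m => by
      have he : Continuous fun z : ℂ => exp (I * z) := by fun_prop
      rw [cfc_sub (fun z => exp (((m : ℤ) : ℂ) * η * I) • g m z) (fun z => g m z * exp (I * z)) _
          ((hgc m).const_smul (exp (((m : ℤ) : ℂ) * η * I))).continuousOn ((hgc m).mul he).continuousOn,
        cfc_smul _ _ _ (hgc m).continuousOn,
        cfc_mul _ _ _ (hgc m).continuousOn he.continuousOn, hUV']
      rfl
    simp only [hD]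
    rw [mul_pow]
    refine sum_norm_cfc_apply_sq_le univ (fun m => ?_) (by positivity) (fun z hz => ?_) x
    · have := hgc m
      fun_prop
    rw [← mul_one (η ^ 2), ← hgs z hz, mul_sum]
    refine sum_le_sum fun m _ => ?_
    obtain ⟨y, rfl, hy⟩ := hspec z hz
    rw [smul_eq_mul, mul_comm (exp _), ← mul_sub, norm_mul, mul_pow, mul_comm]
    by_cases h : 1 ≤ |y / η - (m : ℤ)|
    · rw [hgn, ofReal_re, hat_eq_zero h]; simp
    -- On the support of the hat `|m η - y| ≤ η`, so the phases `exp (i m η)` and `exp (i y)` differ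
    -- by at most `η`.
    · refine mul_le_mul_of_nonneg_right (pow_le_pow_left₀ (norm_nonneg _) ?_ 2) (by positivity)
      have h1 : exp (((m : ℤ) : ℂ) * η * I) - exp (I * y) =
          exp (I * y) * (exp (I * (((m : ℤ) * η - y : ℝ) : ℂ)) - 1) := by
        rw [mul_sub, ← exp_add, mul_one]; congr 2; push_cast; ring
      rw [h1, norm_mul, norm_exp_I_mul_ofReal, one_mul]
      refine (Real.norm_exp_I_mul_ofReal_sub_one_le).trans ?_
      have h2 : ((m : ℤ) : ℝ) * η - y = -(y / η - (m : ℤ)) * η := by field_simp; ring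
      rw [h2, norm_mul, norm_neg, Real.norm_eq_abs, Real.norm_eq_abs, abs_of_pos hη]
      exact mul_le_of_le_one_left hη.le (not_le.1 h).le

end FunctionalCalculus

/-! ### The sharp modulus of continuity and its Lipschitz consequence. -/

section Main

variable {H : Type*} [NormedAddCommGroup H] [InnerProductSpace ℂ H] [CompleteSpace H]

lemma trigOp_eq_of_degree_zero {f : LaurentPolynomial ℂ} (hf : TrigDegreeLE f 0)
    (U V : unitary (H →L[ℂ] H)) : trigOp f U = trigOp f V := by
  rw [trigOp_eq_sum, trigOp_eq_sum]
  refine Finset.sum_congr rfl fun k hk => ?_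
  obtain rfl : k = 0 := by simpa using hf.abs_le hk
  simp

/-- The sharp estimate for the operator modulus of continuity of a trigonometric polynomial. -/
theorem norm_trigOp_sub_le_bernsteinBeta {f : LaurentPolynomial ℂ} {d : ℕ} (hf : TrigDegreeLE f d)
    (hf1 : ∀ z : Circle, ‖trigVal f z‖ ≤ 1) (U V : unitary (H →L[ℂ] H)) :
    ‖trigOp f U - trigOp f V‖ ≤
      bernsteinBeta d (2 * Real.arcsin (‖(U : H →L[ℂ] H) - V‖ / 2)) := by
  set δ := ‖(U : H →L[ℂ] H) - V‖ with hδ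
  set θ := 2 * Real.arcsin (δ / 2) with hθ
  have hδ0 : 0 ≤ δ := norm_nonneg _
  have htwo : ‖trigOp f U - trigOp f V‖ ≤ 2 := by
    have h1 := norm_trigOp_le_one hf1 U
    have h2 := norm_trigOp_le_one hf1 V
    exact (norm_sub_le _ _).trans (by linarith)
  rw [bernsteinBeta]
  split_ifs with h
  swap
  · exact htwo
  rcases h.eq_or_lt with h | h
  · rw [h, Real.sin_pi_div_two]; linarith
  rcases Nat.eq_zero_or_pos d with rfl | hd
  · simp [trigOp_eq_of_degree_zero hf U V]
  have hdr : (1 : ℝ) ≤ d := by exact_mod_cast hd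
  rcases hδ0.eq_or_lt with h0 | h0
  · have : U = V := Subtype.ext (sub_eq_zero.1 (norm_eq_zero.1 h0.symm))
    simp [this, hθ, ← h0]
  have hθ0 : 0 < θ := by
    have : 0 < Real.arcsin (δ / 2) := Real.arcsin_pos.2 (by positivity)
    positivity
  have hθpi : θ < Real.pi := by nlinarith
  have hδ2 : δ < 2 := by
    have : Real.arcsin (δ / 2) < Real.pi / 2 := by linarith
    have := Real.arcsin_lt_pi_div_two.1 this
    linarith
  have hu : ‖((U * V⁻¹ : unitary (H →L[ℂ] H)) : H →L[ℂ] H) - 1‖ = δ := by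
    rw [hδ, Unitary.norm_sub_eq]; rfl
  set A := Unitary.argSelfAdjoint (U * V⁻¹) with hA
  have hexp : U * V⁻¹ = selfAdjoint.expUnitary A :=
    (expUnitary_argSelfAdjoint (by rw [hu]; exact hδ2)).symm
  have hAn : ‖A‖ = θ := by
    have h1 := Unitary.two_mul_one_sub_cos_norm_argSelfAdjoint (u := U * V⁻¹)
      (by rw [hu]; exact hδ2)
    rw [hu, ← hA] at h1
    have hpi := Unitary.norm_argSelfAdjoint_le_pi (U * V⁻¹)
    rw [← hA] at hpi
    -- The chord-arc relation `2 sin (‖A‖ / 2) = δ`; it inverts to `‖A‖ = θ` because `‖A‖ ≤ π`.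
    have hs : Real.sin (‖A‖ / 2) = δ / 2 := by
      have h2 : Real.cos ‖A‖ = 1 - 2 * Real.sin (‖A‖ / 2) ^ 2 := by
        rw [← Real.cos_sq_add_sin_sq (‖A‖ / 2), ← mul_div_cancel₀ ‖A‖ (two_ne_zero (α := ℝ)),
          mul_div_assoc, Real.cos_two_mul]
        ring_nf
        have := Real.sin_sq_add_cos_sq (‖A‖ * (1 / 2))
        linarith
      have h3 : 0 ≤ Real.sin (‖A‖ / 2) :=
        Real.sin_nonneg_of_nonneg_of_le_pi (by positivity) (by linarith [norm_nonneg A])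
      rw [← sq_eq_sq₀ h3 (by positivity)]
      linarith
    rw [hθ, ← hs, Real.arcsin_sin (by linarith [norm_nonneg A, Real.pi_pos]) (by linarith)]
    ring
  -- Here `M = n + 1` and `η = θ / (n + 1)`: the product `M η` remains `θ` while the mesh tends to
  -- zero.
  have key : ∀ n : ℕ, ‖trigOp f U - trigOp f V‖ ≤ 2 * Real.sin (d * θ / 2) +
      (∑ k ∈ f.coeff.support, ‖f.coeff k‖ * |(k : ℝ)|) * (θ / (n + 1 : ℕ)) := fun n => by
    have hn : ((n + 1 : ℕ) : ℝ) * (θ / (n + 1 : ℕ)) = θ := by field_simp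
    have := norm_trigOp_sub_le_of_expUnitary hf hf1 hd n.succ_pos (η := θ / (n + 1 : ℕ))
      (by positivity) (by rw [Nat.succ_eq_add_one, hn]; exact h) U V A
      (by rw [Nat.succ_eq_add_one, hn, hAn]) hexp
    rwa [Nat.succ_eq_add_one, hn] at this
  have hlim := ((tendsto_const_div_atTop_nhds_zero_nat θ).comp (Filter.tendsto_add_atTop_nat 1)).const_mul
    (∑ k ∈ f.coeff.support, ‖f.coeff k‖ * |(k : ℝ)|) |>.const_add (2 * Real.sin (d * θ / 2))
  rw [mul_zero, add_zero] at hlim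
  exact ge_of_tendsto' hlim key

lemma sin_nat_mul_le (d : ℕ) {x : ℝ} (hx : 0 ≤ x) (hx2 : x ≤ Real.pi) :
    |Real.sin (d * x)| ≤ d * Real.sin x := by
  have hs := Real.sin_nonneg_of_nonneg_of_le_pi hx hx2
  induction d with
  | zero => simp
  | succ d ih =>
    push_cast
    rw [add_mul, one_mul, Real.sin_add, add_mul, one_mul]
    refine (abs_add_le _ _).trans (add_le_add ?_ ?_)
    · rw [abs_mul]
      exact (mul_le_of_le_one_right (abs_nonneg _) (Real.abs_cos_le_one _)).trans ih
    · rw [abs_mul, abs_of_nonneg hs]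
      exact mul_le_of_le_one_left hs (Real.abs_cos_le_one _)

lemma bernsteinBeta_two_mul_arcsin_le (d : ℕ) {δ : ℝ} (h0 : 0 ≤ δ) (h2 : δ ≤ 2) :
    bernsteinBeta d (2 * Real.arcsin (δ / 2)) ≤ d * δ := by
  have ha := Real.arcsin_nonneg.2 (show 0 ≤ δ / 2 by positivity)
  have ha2 := Real.arcsin_le_pi_div_two (δ / 2)
  have hpi := Real.pi_pos
  have hsin : Real.sin (Real.arcsin (δ / 2)) = δ / 2 := Real.sin_arcsin (by linarith) (by linarith)
  rw [bernsteinBeta]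
  split_ifs with h
  · have := (le_abs_self _).trans (sin_nat_mul_le d ha (by linarith))
    rw [hsin] at this
    rw [show (d : ℝ) * (2 * Real.arcsin (δ / 2)) / 2 = d * Real.arcsin (δ / 2) by ring]
    linarith
  · have hd : (0 : ℝ) < d := by
      by_contra hd
      obtain rfl : d = 0 := by
        have : (d : ℝ) = 0 := le_antisymm (not_lt.1 hd) (Nat.cast_nonneg d)
        exact_mod_cast this
      simp [hpi.le] at h
    have h1 : Real.pi / 2 / d ≤ Real.arcsin (δ / 2) := by
      rw [div_le_iff₀ hd]
      linarith
    -- When `d θ > π` the sine bound is used at the smaller angle `π / (2 d)`, where it already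
    -- gives `1 ≤ d sin (π / (2 d)) ≤ d δ / 2`.
    have h3 := (le_abs_self _).trans (sin_nat_mul_le d (x := Real.pi / 2 / d) (by positivity) (by linarith))
    rw [mul_div_cancel₀ _ hd.ne', Real.sin_pi_div_two] at h3
    have h4 : Real.sin (Real.pi / 2 / d) ≤ δ / 2 := by
      rw [← hsin]
      exact Real.sin_le_sin_of_le_of_le_pi_div_two
        (by have : 0 ≤ Real.pi / 2 / d := by positivity
            linarith) ha2 h1
    nlinarith

theorem norm_trigOp_sub_le {f : LaurentPolynomial ℂ} {d : ℕ} (hf : TrigDegreeLE f d)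
    (hf1 : ∀ z : Circle, ‖trigVal f z‖ ≤ 1) (U V : unitary (H →L[ℂ] H)) :
    ‖trigOp f U - trigOp f V‖ ≤ d * ‖(U : H →L[ℂ] H) - V‖ := by
  refine (norm_trigOp_sub_le_bernsteinBeta hf hf1 U V).trans
    (bernsteinBeta_two_mul_arcsin_le d (norm_nonneg _) ((norm_sub_le _ _).trans ?_))
  linarith [norm_unitary_le U, norm_unitary_le V]

end Main

/-! ### Norm of the divided difference transformer. -/

section Transformer

open Complex

variable {H : Type*} [NormedAddCommGroup H] [InnerProductSpace ℂ H] [CompleteSpace H]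

lemma exists_unitary_path {B : Type*} [CStarAlgebra B] (a : selfAdjoint B) :
    ∃ E : ℝ → unitary B, Filter.Tendsto E (𝓝[≠] 0) (𝓝 1) ∧
      Filter.Tendsto (fun s : ℝ => (s⁻¹ : ℂ) • ((E s : B) - 1)) (𝓝[≠] 0) (𝓝 (I • (a : B))) := by
  set E : ℝ → unitary B := fun s => selfAdjoint.expUnitary (s • a) with hE
  have hEc : ∀ s, (E s : B) = NormedSpace.exp (s • (I • (a : B))) := fun s => by
    rw [hE, selfAdjoint.expUnitary_coe, selfAdjoint.val_smul, smul_comm]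
  refine ⟨E, ?_, ?_⟩
  · have : Continuous E :=
      selfAdjoint.continuous_expUnitary.comp (continuous_id.smul continuous_const)
    have h := this.tendsto 0
    rw [show E 0 = 1 by ext1; simp [hEc]] at h
    exact h.mono_left nhdsWithin_le_nhds
  · have h := (hasDerivAt_exp_smul_const (𝕂 := ℝ) (I • (a : B)) (0 : ℝ))
    rw [hasDerivAt_iff_tendsto_slope_zero] at h
    simp only [zero_smul, NormedSpace.exp_zero, one_mul, zero_add] at h
    refine h.congr fun s => ?_
    rw [hEc, ← ofReal_inv, coe_smul]

lemma diagUnitary_zpow_apply {ι : Type*} [Fintype ι] (u : ι → unitary (H →L[ℂ] H)) (k : ℤ)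
    (x : PiLp 2 (fun _ : ι => H)) (i : ι) :
    ((diagUnitary u ^ k : unitary (PiLp 2 (fun _ : ι => H) →L[ℂ] PiLp 2 (fun _ : ι => H))) :
      PiLp 2 (fun _ : ι => H) →L[ℂ] PiLp 2 (fun _ : ι => H)) x i =
      ((u i ^ k : unitary (H →L[ℂ] H)) : H →L[ℂ] H) (x i) := by
  rw [← map_zpow]; rfl

/-- The Lipschitz bound for the pair `exp (i s A) U`, `U`, divided by `s`; as `s → 0` the difference
quotient tends to `i A U`, and the commutator identity with `R = 1` identifies the left side. -/
lemma norm_divDiff_selfAdjoint_le {f : LaurentPolynomial ℂ} {d : ℕ} (hf : TrigDegreeLE f d)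
    (hf1 : ∀ z : Circle, ‖trigVal f z‖ ≤ 1) (U : unitary (H →L[ℂ] H))
    (A : selfAdjoint (H →L[ℂ] H)) :
    ‖divDiff f U U (I • (A : H →L[ℂ] H) * U)‖ ≤ d * ‖I • (A : H →L[ℂ] H) * U‖ := by
  obtain ⟨E, hE, hslope⟩ := exists_unitary_path A
  have hEt : Filter.Tendsto (fun s => E s * U) (𝓝[≠] 0) (𝓝 U) := by
    simpa using hE.mul_const U
  have hslope : Filter.Tendsto (fun s : ℝ => (s⁻¹ : ℂ) • ((E s * U : unitary (H →L[ℂ] H)) - (U : H →L[ℂ] H)))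
      (𝓝[≠] 0) (𝓝 (I • (A : H →L[ℂ] H) * U)) := by
    refine (hslope.mul_const (U : H →L[ℂ] H)).congr fun s => ?_
    rw [Submonoid.coe_mul, smul_mul_assoc, sub_mul, one_mul]
  have h1 := ((continuous_divDiff_left f U).tendsto (U, I • (A : H →L[ℂ] H) * U)).comp
    (hEt.prodMk_nhds hslope)
  refine le_of_tendsto_of_tendsto' h1.norm (hslope.norm.const_mul (d : ℝ)) fun s => ?_
  simp only [Function.comp_apply, map_smul, norm_smul]
  have h2 := divDiff_commutator f (E s * U) U 1
  simp only [mul_one, one_mul] at h2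
  rw [h2, mul_left_comm]
  exact mul_le_mul_of_nonneg_left (norm_trigOp_sub_le hf hf1 _ _) (norm_nonneg _)

/-- The transformer of the divided difference has norm at most the degree. -/
theorem norm_divDiff_le {f : LaurentPolynomial ℂ} {d : ℕ} (hf : TrigDegreeLE f d)
    (hf1 : ∀ z : Circle, ‖trigVal f z‖ ≤ 1) (U V : unitary (H →L[ℂ] H)) (X : H →L[ℂ] H) :
    ‖divDiff f U V X‖ ≤ d * ‖X‖ := by
  let u : Fin 2 → unitary (H →L[ℂ] H) := ![U, V]
  -- `Z` is chosen so that `i Z V = X`. With `A` the self-adjoint block matrix having corners `Z`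
  -- and `Z*`, the operator `i A diag(U, V)` has `X` as its upper right corner.
  let Z : H →L[ℂ] H := -I • (X * ((V⁻¹ : unitary (H →L[ℂ] H)) : H →L[ℂ] H))
  have hZ : ‖Z‖ ≤ ‖X‖ := by
    rw [norm_smul, norm_neg, norm_I, one_mul]
    exact (norm_mul_le _ _).trans (mul_le_of_le_one_right (norm_nonneg _) (norm_unitary_le _))
  let A : PiLp 2 (fun _ : Fin 2 => H) →L[ℂ] PiLp 2 (fun _ : Fin 2 => H) :=
    stack ![Z ∘L blockProj 1, Z.adjoint ∘L blockProj 0]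
  have hA : IsSelfAdjoint A := by
    rw [ContinuousLinearMap.isSelfAdjoint_iff', eq_comm, ContinuousLinearMap.eq_adjoint_iff]
    intro x y
    simp only [PiLp.inner_apply, Fin.sum_univ_two, A, stack_apply]
    simp [ContinuousLinearMap.adjoint_inner_left, ContinuousLinearMap.adjoint_inner_right, add_comm]
  have hAn : ‖A‖ ≤ ‖X‖ := by
    refine ContinuousLinearMap.opNorm_le_bound _ (norm_nonneg _) fun x => ?_
    refine le_of_sq_le_sq ?_ (by positivity)
    rw [norm_stack_sq, mul_pow, PiLp.norm_sq_eq_of_L2, Fin.sum_univ_two, Fin.sum_univ_two, mul_add,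
      add_comm]
    have h1 : ‖Z (x 1)‖ ≤ ‖X‖ * ‖x 1‖ :=
      (Z.le_opNorm _).trans (mul_le_mul_of_nonneg_right hZ (norm_nonneg _))
    have h2 : ‖Z.adjoint (x 0)‖ ≤ ‖X‖ * ‖x 0‖ :=
      (ContinuousLinearMap.le_opNorm _ _).trans
        (mul_le_mul_of_nonneg_right (by rwa [LinearIsometryEquiv.norm_map]) (norm_nonneg _))
    rw [← mul_pow, ← mul_pow]
    exact add_le_add (pow_le_pow_left₀ (norm_nonneg _) h2 2) (pow_le_pow_left₀ (norm_nonneg _) h1 2)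
  have key := norm_divDiff_selfAdjoint_le hf hf1 (diagUnitary u) ⟨A, hA⟩
  set D := divDiff f (diagUnitary u) (diagUnitary u) (I • A * (diagUnitary u : _ →L[ℂ] _)) with hD
  have hX : (blockProj 0 : PiLp 2 (fun _ : Fin 2 => H) →L[ℂ] H) ∘L
      (I • A * (diagUnitary u : _ →L[ℂ] _)) ∘L blockSingle 1 = X := by
    ext x
    simp only [ContinuousLinearMap.comp_apply, blockProj_apply, mul_apply_eq_comp,
      _root_.smul_apply, PiLp.smul_apply, A, stack_apply]
    simp [u, Z, smul_smul, coe_unitary_inv_mul]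
  have hcomp : (blockProj 0 : PiLp 2 (fun _ : Fin 2 => H) →L[ℂ] H) ∘L D ∘L blockSingle 1 =
      divDiff f U V X := by
    rw [hD, comp_divDiff_comp f (U := U) (V := V), hX]
    · intro j
      ext x
      exact diagUnitary_zpow_apply u j x 0
    · intro j
      ext x i
      refine (diagUnitary_zpow_apply u j _ i).trans ?_
      fin_cases i <;> simp [u]
  rw [← hcomp]
  refine ContinuousLinearMap.opNorm_le_bound _ (by positivity) fun x => ?_
  refine (PiLp.norm_apply_le (D (blockSingle 1 x)) 0).trans ((D.le_opNorm _).trans ?_)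
  rw [norm_blockSingle_apply]
  refine mul_le_mul_of_nonneg_right (key.trans (mul_le_mul_of_nonneg_left ?_ (Nat.cast_nonneg _)))
    (norm_nonneg _)
  refine (norm_mul_le _ _).trans ((mul_le_of_le_one_right (norm_nonneg _) (norm_unitary_le _)).trans ?_)
  rw [norm_smul, norm_I, one_mul]
  exact hAn

theorem norm_trigOp_commutator_le {f : LaurentPolynomial ℂ} {d : ℕ} (hf : TrigDegreeLE f d)
    (hf1 : ∀ z : Circle, ‖trigVal f z‖ ≤ 1) (U V : unitary (H →L[ℂ] H)) (R : H →L[ℂ] H) :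
    ‖trigOp f U * R - R * trigOp f V‖ ≤ d * ‖(U : H →L[ℂ] H) * R - R * V‖ := by
  rw [← divDiff_commutator]
  exact norm_divDiff_le hf hf1 U V _

end Transformer

/-! ### Singular values and singular vectors. -/

section SingularValues

open Finset InnerProductSpace

variable {H : Type*} [NormedAddCommGroup H] [InnerProductSpace ℂ H] [CompleteSpace H]

omit [CompleteSpace H] in
lemma singVal_le {T R : H →L[ℂ] H} {j : ℕ}
    (hR : LinearMap.rank (R : H →ₗ[ℂ] H) ≤ (j : Cardinal)) : singVal T j ≤ ‖T - R‖ :=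
  csInf_le ⟨0, by rintro _ ⟨R, -, rfl⟩; exact norm_nonneg _⟩ ⟨R, hR, rfl⟩

omit [CompleteSpace H] in
lemma le_singVal {T : H →L[ℂ] H} {j : ℕ} {c : ℝ}
    (h : ∀ R : H →L[ℂ] H, LinearMap.rank (R : H →ₗ[ℂ] H) ≤ (j : Cardinal) → c ≤ ‖T - R‖) :
    c ≤ singVal T j :=
  le_csInf ⟨‖T - 0‖, 0, by simp, rfl⟩ (by rintro _ ⟨R, hR, rfl⟩; exact h R hR)

omit [CompleteSpace H] in
lemma singVal_nonneg (T : H →L[ℂ] H) (j : ℕ) : 0 ≤ singVal T j :=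
  le_singVal fun _ _ => norm_nonneg _

omit [CompleteSpace H] in
lemma singVal_antitone (T : H →L[ℂ] H) : Antitone (singVal T) := fun i j hij =>
  le_singVal fun _ hR => singVal_le (hR.trans (by exact_mod_cast hij))

omit [CompleteSpace H] in
lemma singVal_add_le (S T : H →L[ℂ] H) (j : ℕ) : singVal (S + T) j ≤ singVal S j + ‖T‖ := by
  rw [← sub_le_iff_le_add]
  refine le_singVal fun R hR => ?_
  rw [sub_le_iff_le_add]
  refine (singVal_le hR).trans ?_
  rw [show S + T - R = S - R + T by abel]
  exact norm_add_le _ _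

omit [CompleteSpace H] in
lemma kyFanNorm_add_le (l : ℕ) (S T : H →L[ℂ] H) :
    kyFanNorm l (S + T) ≤ kyFanNorm l S + (l + 1) * ‖T‖ := by
  refine (sum_le_sum fun j _ => singVal_add_le S T j).trans_eq ?_
  rw [sum_add_distrib, kyFanNorm]
  simp

omit [CompleteSpace H] in
lemma mul_singVal_le_singVal_smul {c : ℂ} (hc : c ≠ 0) (T : H →L[ℂ] H) (j : ℕ) :
    ‖c‖ * singVal T j ≤ singVal (c • T) j := by
  refine le_singVal fun R hR => ?_
  have h1 : c • T - R = c • (T - c⁻¹ • R) := by rw [smul_sub, smul_inv_smul₀ hc]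
  rw [h1, norm_smul]
  refine mul_le_mul_of_nonneg_left (singVal_le (le_trans ?_ hR)) (norm_nonneg _)
  have : ((c⁻¹ • R : H →L[ℂ] H) : H →ₗ[ℂ] H) = (c⁻¹ • LinearMap.id : H →ₗ[ℂ] H) ∘ₗ (R : H →ₗ[ℂ] H) := by
    ext; simp
  rw [this]
  exact LinearMap.rank_comp_le_right _ _

omit [CompleteSpace H] in
/-- The lower estimate in the max-min characterization of singular values. -/
lemma le_singVal_of_lt_rank {T : H →L[ℂ] H} {j : ℕ} {c : ℝ} (W : Submodule ℂ H)
    (hW : (j : Cardinal) < Module.rank ℂ W) (h : ∀ x ∈ W, c * ‖x‖ ≤ ‖T x‖) :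
    c ≤ singVal T j := by
  refine le_singVal fun R hR => ?_
  -- An `R` of rank at most `j` must kill a nonzero vector of `W`, on which `T` and `T - R` agree.
  have hinj : ¬ Function.Injective ((R : H →ₗ[ℂ] H) ∘ₗ W.subtype) := fun hi => by
    have h1 := rank_range_of_injective _ hi
    have h2 := LinearMap.rank_comp_le_left W.subtype (R : H →ₗ[ℂ] H)
    rw [LinearMap.rank, h1] at h2
    exact absurd (h2.trans hR) (not_le.2 hW)
  rw [← LinearMap.ker_eq_bot, Submodule.eq_bot_iff] at hinj
  push Not at hinj
  obtain ⟨x, hx, hx0⟩ := hinj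
  have hx1 : R x = 0 := hx
  have hxp : 0 < ‖(x : H)‖ := norm_pos_iff.2 fun h => hx0 (Subtype.ext h)
  have h3 := h x x.2
  have h4 := (T - R).le_opNorm x
  rw [_root_.sub_apply, hx1, sub_zero] at h4
  exact le_of_mul_le_mul_right (h3.trans h4) hxp

section Orthonormal

variable {n : ℕ} {e f : Fin n → H}

omit [CompleteSpace H] in
lemma norm_sum_smul_sq {f : Fin n → H} (hf : Orthonormal ℂ f) (a : Fin n → ℂ) :
    ‖∑ i, a i • f i‖ ^ 2 = ∑ i, ‖a i‖ ^ 2 := by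
  have h := hf.inner_sum a a univ
  rw [inner_self_eq_norm_sq_to_K] at h
  have h2 : ∀ i, (starRingEnd ℂ) (a i) * a i = ((‖a i‖ ^ 2 : ℝ) : ℂ) := fun i => by
    rw [Complex.conj_mul']; push_cast; rfl
  simp only [h2] at h
  rw [← Complex.ofReal_sum] at h
  apply Complex.ofReal_injective
  rw [Complex.ofReal_pow]
  exact h

omit [CompleteSpace H] in
lemma norm_sum_rankOne_le (he : Orthonormal ℂ e) (hf : Orthonormal ℂ f) {t : Fin n → ℝ} {c : ℝ}
    (hc : 0 ≤ c) (ht : ∀ i, |t i| ≤ c) : ‖∑ i, (t i : ℂ) • rankOne ℂ (f i) (e i)‖ ≤ c := by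
  refine ContinuousLinearMap.opNorm_le_bound _ hc fun x => ?_
  refine le_of_sq_le_sq ?_ (by positivity)
  have h1 : (∑ i, (t i : ℂ) • rankOne ℂ (f i) (e i)) x =
      ∑ i, ((t i : ℂ) * inner ℂ (e i) x) • f i := by
    rw [_root_.sum_apply]
    refine sum_congr rfl fun i _ => ?_
    rw [_root_.smul_apply, rankOne_apply, smul_smul]
  rw [h1, norm_sum_smul_sq hf, mul_pow]
  refine le_trans ?_ (mul_le_mul_of_nonneg_left (he.sum_inner_products_le x (s := univ)) (sq_nonneg c))
  rw [mul_sum]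
  refine sum_le_sum fun i _ => ?_
  rw [norm_mul, mul_pow, Complex.norm_real, Real.norm_eq_abs]
  exact mul_le_mul_of_nonneg_right (pow_le_pow_left₀ (abs_nonneg _) (ht i) 2) (sq_nonneg _)

omit [CompleteSpace H] in
lemma rank_sum_rankOne_le {ι : Type*} (s : Finset ι) (t : ι → ℂ) (e f : ι → H) :
    LinearMap.rank ((∑ i ∈ s, t i • rankOne ℂ (f i) (e i) : H →L[ℂ] H) : H →ₗ[ℂ] H) ≤
      (s.card : Cardinal) := by
  classical
  have : LinearMap.range ((∑ i ∈ s, t i • rankOne ℂ (f i) (e i) : H →L[ℂ] H) : H →ₗ[ℂ] H) ≤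
      Submodule.span ℂ (s.image f : Set H) := by
    rintro _ ⟨x, rfl⟩
    rw [ContinuousLinearMap.coe_coe, _root_.sum_apply]
    refine Submodule.sum_mem _ fun i hi => Submodule.smul_mem _ _ (Submodule.smul_mem _ _ ?_)
    exact Submodule.subset_span (mem_coe.2 (mem_image_of_mem f hi))
  refine (Submodule.rank_mono this).trans ((rank_span_finset_le _).trans ?_)
  exact_mod_cast card_image_le

omit [CompleteSpace H] in
-- The first `j` terms form a competitor of rank at most `j`, and the norm of the remainder is at
-- most its largest coefficient.
lemma singVal_sum_rankOne_le (he : Orthonormal ℂ e) (hf : Orthonormal ℂ f) {t : Fin n → ℝ}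
    (ht : Antitone t) (ht0 : ∀ i, 0 ≤ t i) (j : ℕ) :
    singVal (∑ i, (t i : ℂ) • rankOne ℂ (f i) (e i)) j ≤ if h : j < n then t ⟨j, h⟩ else 0 := by
  have hR := rank_sum_rankOne_le (univ.filter fun i : Fin n => (i : ℕ) < j) (fun i => (t i : ℂ)) e f
  have hcard : (univ.filter fun i : Fin n => (i : ℕ) < j).card ≤ j := by
    have h1 := card_le_card_of_injOn (s := univ.filter fun i : Fin n => (i : ℕ) < j)
      (t := range j) (fun i : Fin n => (i : ℕ)) (fun i hi => by simpa using hi)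
      (fun a _ b _ h => Fin.ext h)
    simpa using h1
  refine (singVal_le (hR.trans (by exact_mod_cast hcard))).trans ?_
  have h2 : (∑ i, (t i : ℂ) • rankOne ℂ (f i) (e i)) -
      ∑ i ∈ univ.filter fun i : Fin n => (i : ℕ) < j, (t i : ℂ) • rankOne ℂ (f i) (e i) =
      ∑ i : Fin n, ((if (i : ℕ) < j then 0 else t i : ℝ) : ℂ) • rankOne ℂ (f i) (e i) := by
    rw [sum_filter, ← sum_sub_distrib]
    refine sum_congr rfl fun i _ => ?_
    split_ifs <;> simp
  rw [h2]
  refine norm_sum_rankOne_le he hf ?_ fun i => ?_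
  · split_ifs with h
    exacts [ht0 _, le_rfl]
  · split_ifs with h1 h2 h2
    · simpa using ht0 _
    · simp
    · rw [abs_of_nonneg (ht0 i)]
      exact ht (Fin.le_def.2 (not_lt.1 h1))
    · exact absurd i.2 (by omega)

omit [CompleteSpace H] in
lemma kyFanNorm_sum_rankOne_le (he : Orthonormal ℂ e) (hf : Orthonormal ℂ f) {t : Fin n → ℝ}
    (ht : Antitone t) (ht0 : ∀ i, 0 ≤ t i) (l : ℕ) :
    kyFanNorm l (∑ i, (t i : ℂ) • rankOne ℂ (f i) (e i)) ≤ ∑ i, t i := by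
  refine (sum_le_sum fun j _ => singVal_sum_rankOne_le he hf ht ht0 j).trans ?_
  set F : ℕ → ℝ := fun j => if h : j < n then t ⟨j, h⟩ else 0 with hF
  have hF0 : ∀ j, 0 ≤ F j := fun j => by
    simp only [hF]; split_ifs
    exacts [ht0 _, le_rfl]
  have h1 : ∑ i, t i = ∑ j ∈ range n, F j := by
    rw [← Fin.sum_univ_eq_sum_range]
    refine sum_congr rfl fun i _ => ?_
    simp [hF]
  rw [h1]
  refine (sum_le_sum_of_subset_of_nonneg (range_subset_range.2 (le_max_left (l + 1) n))
    fun j _ _ => hF0 j).trans_eq ?_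
  refine (sum_subset (range_subset_range.2 (le_max_right (l + 1) n)) fun j _ hj => ?_).symm
  simp only [mem_range, not_lt] at hj
  simp [hF, not_lt.2 hj]

omit [CompleteSpace H] in
/-- Singular vectors give lower estimates for the singular values. -/
lemma le_singVal_of_singular_vectors (he : Orthonormal ℂ e) (hf : Orthonormal ℂ f) {s : Fin n → ℝ}
    (hs : Antitone s) (hs0 : ∀ i, 0 ≤ s i) {X : H →L[ℂ] H} (hX : ∀ i, X (e i) = (s i : ℂ) • f i)
    (i : Fin n) : s i ≤ singVal X i := by
  let g : Fin (i + 1) → Fin n := Fin.castLE i.2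
  have hg : Function.Injective g := Fin.castLE_injective _
  refine le_singVal_of_lt_rank (Submodule.span ℂ (Set.range (e ∘ g))) ?_ fun x hx => ?_
  · have := FiniteDimensional.span_of_finite ℂ (Set.finite_range (e ∘ g))
    rw [← Module.finrank_eq_rank, finrank_span_eq_card (he.comp g hg).linearIndependent,
      Fintype.card_fin]
    exact_mod_cast Nat.lt_succ_self _
  · obtain ⟨a, rfl⟩ := (Submodule.mem_span_range_iff_exists_fun ℂ).1 hx
    refine le_of_sq_le_sq ?_ (norm_nonneg _)
    rw [map_sum]
    simp only [map_smul, Function.comp_apply, hX, smul_smul]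
    rw [norm_sum_smul_sq (f := fun k => f (g k)) (hf.comp g hg), mul_pow,
      norm_sum_smul_sq (f := fun k => e (g k)) (he.comp g hg), mul_sum]
    refine sum_le_sum fun k _ => ?_
    rw [norm_mul, mul_pow, Complex.norm_real, Real.norm_eq_abs, sq_abs, mul_comm]
    refine mul_le_mul_of_nonneg_left (pow_le_pow_left₀ (hs0 i) (hs ?_) 2) (sq_nonneg _)
    exact Fin.le_def.2 (Nat.lt_succ_iff.1 k.2)

end Orthonormal

/-- The part of an operator above a level `c` that exceeds the singular value `s_l`: it is given by
finitely many singular vectors, and what remains after lowering their singular values to `c` has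
norm at most `c`. -/
lemma exists_singular_vectors (X : H →L[ℂ] H) (l : ℕ) {c : ℝ} (hc : singVal X l < c) :
    ∃ (n : ℕ) (e f : Fin n → H) (s : Fin n → ℝ), n ≤ l ∧ Orthonormal ℂ e ∧ Orthonormal ℂ f ∧
      Antitone s ∧ (∀ i, c ≤ s i) ∧ (∀ i, X (e i) = (s i : ℂ) • f i) ∧
      ‖X - ∑ i, ((s i - c : ℝ) : ℂ) • rankOne ℂ (f i) (e i)‖ ≤ c := by
  have hc0 : 0 < c := (singVal_nonneg X l).trans_lt hc
  -- The positive part `P` of `X* X - c²` isolates the part of `X` above the level `c`. On its range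
  -- `X` is bounded below by `c`, and on the orthogonal complement above by `c`.
  set B : H →L[ℂ] H := X.adjoint ∘L X - ((c ^ 2 : ℝ) : ℂ) • 1 with hB
  have hBsa : IsSelfAdjoint B := by
    refine IsSelfAdjoint.sub ?_ (IsSelfAdjoint.smul ?_ (IsSelfAdjoint.one _))
    · exact IsSelfAdjoint.star_mul_self X
    · exact Complex.conj_ofReal _
  set P : H →L[ℂ] H := B⁺ with hP
  set N : H →L[ℂ] H := B⁻ with hN
  have hPN : P - N = B := CFC.posPart_sub_negPart B hBsa
  have hNP : ∀ x, N (P x) = 0 := fun x => DFunLike.congr_fun (CFC.negPart_mul_posPart B) x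
  have hP0 : P.IsPositive := (ContinuousLinearMap.nonneg_iff_isPositive P).1 (CFC.posPart_nonneg B)
  have hN0 : N.IsPositive := (ContinuousLinearMap.nonneg_iff_isPositive N).1 (CFC.negPart_nonneg B)
  have hXX : ∀ x, X.adjoint (X x) = ((c ^ 2 : ℝ) : ℂ) • x + P x - N x := fun x => by
    have := DFunLike.congr_fun hPN x
    simp only [hB, _root_.sub_apply, ContinuousLinearMap.comp_apply, _root_.smul_apply,
      one_apply_eq_self] at this
    rw [add_sub_assoc, this]; abel
  have hXn : ∀ x, ‖X x‖ ^ 2 = c ^ 2 * ‖x‖ ^ 2 + (inner ℂ (P x) x).re - (inner ℂ (N x) x).re := by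
    intro x
    rw [ContinuousLinearMap.apply_norm_sq_eq_inner_adjoint_left, ContinuousLinearMap.comp_apply, hXX,
      inner_sub_left, inner_add_left, inner_smul_left,
      show inner ℂ x x = ((‖x‖ ^ 2 : ℝ) : ℂ) by
        rw [inner_self_eq_norm_sq_to_K, Complex.ofReal_pow]; rfl]
    simp only [RCLike.re_eq_complex_re, Complex.sub_re, Complex.add_re, Complex.conj_ofReal,
      Complex.re_ofReal_mul, Complex.ofReal_re]
  set W := LinearMap.range (P : H →ₗ[ℂ] H) with hW
  have hWX : ∀ x ∈ W, c * ‖x‖ ≤ ‖X x‖ := by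
    rintro _ ⟨y, rfl⟩
    rw [ContinuousLinearMap.coe_coe]
    refine le_of_sq_le_sq ?_ (norm_nonneg _)
    rw [hXn, hNP, inner_zero_left, mul_pow]
    have := hP0.re_inner_nonneg_left (P y)
    simp only [RCLike.re_eq_complex_re] at this
    simpa using this
  -- A range of dimension greater than `l` would force `s_l(X) ≥ c`. So `P` has finite rank and can
  -- be diagonalized on `W`.
  have hWr : Module.rank ℂ W ≤ (l : Cardinal) := by
    by_contra h
    exact absurd (le_singVal_of_lt_rank W (not_le.1 h) hWX) (not_le.2 hc)
  have : FiniteDimensional ℂ W :=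
    Module.rank_lt_aleph0_iff.1 (hWr.trans_lt (Cardinal.natCast_lt_aleph0))
  have hn : Module.finrank ℂ W ≤ l := by
    rw [← Module.finrank_eq_rank] at hWr; exact_mod_cast hWr
  have hPW : ∀ x ∈ W, (P : H →ₗ[ℂ] H) x ∈ W := fun x _ => ⟨x, rfl⟩
  have hT := hP0.isSymmetric.restrict_invariant hPW
  set b := hT.eigenvectorBasis rfl with hb
  set τ := hT.eigenvalues rfl with hτ
  set e : Fin (Module.finrank ℂ W) → H := fun i => (b i : H) with he
  have heo : Orthonormal ℂ e := b.orthonormal.comp_linearIsometry W.subtypeₗᵢ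
  have hPe : ∀ i, P (e i) = (τ i : ℂ) • e i := fun i =>
    congrArg Subtype.val (hT.apply_eigenvectorBasis rfl i)
  have hNe : ∀ i, N (e i) = 0 := fun i => by
    obtain ⟨y, hy⟩ := (b i).2
    rw [he]; simp only [← hy]; exact hNP y
  have hτ0 : ∀ i, 0 ≤ τ i := fun i => by
    have := hP0.re_inner_nonneg_left (e i)
    rw [hPe, inner_smul_left, inner_self_eq_norm_sq_to_K, heo.1 i] at this
    simpa using this
  have hXe : ∀ i, X.adjoint (X (e i)) = ((c ^ 2 + τ i : ℝ) : ℂ) • e i := fun i => by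
    rw [hXX, hPe, hNe, sub_zero, ← add_smul]; push_cast; rfl
  set s : Fin (Module.finrank ℂ W) → ℝ := fun i => Real.sqrt (c ^ 2 + τ i) with hs
  have hs2 : ∀ i, s i ^ 2 = c ^ 2 + τ i := fun i =>
    Real.sq_sqrt (add_nonneg (sq_nonneg _) (hτ0 i))
  have hsc : ∀ i, c ≤ s i := fun i => Real.le_sqrt_of_sq_le (by linarith [hτ0 i])
  have hsne : ∀ i, (s i : ℂ) ≠ 0 := fun i => by exact_mod_cast (hc0.trans_le (hsc i)).ne'
  set f : Fin (Module.finrank ℂ W) → H := fun i => (s i : ℂ)⁻¹ • X (e i) with hf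
  have hXf : ∀ i, X (e i) = (s i : ℂ) • f i := fun i => by rw [hf, smul_inv_smul₀ (hsne i)]
  have hinner : ∀ i y, inner ℂ (f i) (X y) = (s i : ℂ) * inner ℂ (e i) y := fun i y => by
    rw [hf, inner_smul_left, ← ContinuousLinearMap.adjoint_inner_left, hXe, inner_smul_left, ← hs2,
      map_inv₀, Complex.conj_ofReal, Complex.conj_ofReal]
    have := hsne i
    push_cast
    field_simp
  have hfo : Orthonormal ℂ f := by
    rw [orthonormal_iff_ite]
    intro i j
    rw [show f j = (s j : ℂ)⁻¹ • X (e j) from rfl, inner_smul_right, hinner,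
      orthonormal_iff_ite.1 heo]
    split_ifs with h
    · subst h; simp [hsne]
    · simp
  clear_value f
  refine ⟨_, e, f, s, hn, heo, hfo, fun i j hij => ?_, hsc, hXf, ?_⟩
  · exact Real.sqrt_le_sqrt (add_le_add le_rfl (hT.eigenvalues_antitone rfl hij))
  refine ContinuousLinearMap.opNorm_le_bound _ hc0.le fun x => ?_
  -- `y` is the component of `x` orthogonal to `W`. Both the splitting `x = (x - y) + y` and its
  -- image under the remainder are orthogonal, so the two norm bounds add in squares.
  set y := x - ∑ i, inner ℂ (e i) x • e i with hy
  have hye : ∀ i, inner ℂ (e i) y = 0 := fun i => by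
    rw [hy, inner_sub_right, heo.inner_right_fintype, sub_self]
  have hyW : ∀ z ∈ W, inner ℂ z y = 0 := fun z hz => by
    have : z = ∑ i, inner ℂ (b i) (⟨z, hz⟩ : W) • e i := by
      have h := congrArg Subtype.val (b.sum_repr' ⟨z, hz⟩)
      simp only [Submodule.coe_sum, Submodule.coe_smul] at h
      exact h.symm
    rw [this, sum_inner]
    exact sum_eq_zero fun i _ => by rw [inner_smul_left, hye, mul_zero]
  have hPy : inner ℂ (P y) y = 0 := hyW _ ⟨y, rfl⟩
  have hXy : ‖X y‖ ^ 2 ≤ c ^ 2 * ‖y‖ ^ 2 := by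
    rw [hXn, hPy]
    have := hN0.re_inner_nonneg_left y
    simp only [RCLike.re_eq_complex_re] at this
    simp only [Complex.zero_re]
    linarith
  have hx : x = ∑ i, inner ℂ (e i) x • e i + y := by rw [hy]; abel
  have horth : inner ℂ (∑ i, inner ℂ (e i) x • e i) y = 0 := by
    rw [sum_inner]
    exact sum_eq_zero fun i _ => by rw [inner_smul_left, hye, mul_zero]
  have hxn : ‖x‖ ^ 2 = ∑ i, ‖(inner ℂ (e i) x : ℂ)‖ ^ 2 + ‖y‖ ^ 2 := by
    have := norm_add_sq_eq_norm_sq_add_norm_sq_of_inner_eq_zero _ _ horth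
    rw [← hx] at this
    rw [← norm_sum_smul_sq heo, pow_two, this]; ring
  have hval : (X - ∑ i, ((s i - c : ℝ) : ℂ) • rankOne ℂ (f i) (e i)) x =
      ∑ i, ((c : ℂ) * inner ℂ (e i) x) • f i + X y := by
    have h1 : X x = ∑ i, inner ℂ (e i) x • (s i : ℂ) • f i + X y := by
      conv_lhs => rw [hx]
      rw [map_add, map_sum]
      simp only [map_smul, hXf]
    rw [_root_.sub_apply, h1, _root_.sum_apply, add_sub_right_comm, ← sum_sub_distrib]
    congr 1
    refine sum_congr rfl fun i _ => ?_
    rw [_root_.smul_apply, rankOne_apply, smul_smul, smul_smul, ← sub_smul]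
    congr 1
    push_cast; ring
  have horth2 : inner ℂ (∑ i, ((c : ℂ) * inner ℂ (e i) x) • f i) (X y) = 0 := by
    rw [sum_inner]
    exact sum_eq_zero fun i _ => by rw [inner_smul_left, hinner, hye, mul_zero, mul_zero]
  refine le_of_sq_le_sq ?_ (by positivity)
  have h2 := norm_add_sq_eq_norm_sq_add_norm_sq_of_inner_eq_zero _ _ horth2
  rw [← pow_two, ← pow_two, ← pow_two, norm_sum_smul_sq hfo] at h2
  rw [hval, h2, mul_pow, hxn, mul_add, mul_sum]
  refine add_le_add (sum_le_sum fun i _ => ?_) hXy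
  rw [norm_mul, mul_pow, Complex.norm_real, Real.norm_eq_abs, sq_abs]

end SingularValues

/-! ### Ky Fan norm estimates and ideals with the majorization property. -/

section Majorization

open Finset InnerProductSpace

variable {H : Type*} [NormedAddCommGroup H] [InnerProductSpace ℂ H] [CompleteSpace H]

lemma divDiff_mem (f : LaurentPolynomial ℂ) (U V : unitary (H →L[ℂ] H)) {X : H →L[ℂ] H}
    (S : Submodule ℂ (H →L[ℂ] H)) (h : ∀ A B : H →L[ℂ] H, A * X * B ∈ S) :
    divDiff f U V X ∈ S := by
  rw [divDiff_apply]
  refine S.sum_mem fun k _ => S.smul_mem _ ?_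
  rw [monomialDivDiff_apply]
  exact S.sub_mem (S.sum_mem fun _ _ => h _ _) (S.sum_mem fun _ _ => h _ _)

/-- The operators of finite rank. -/
def finiteRank (H : Type*) [NormedAddCommGroup H] [InnerProductSpace ℂ H] :
    Submodule ℂ (H →L[ℂ] H) where
  carrier := {T | LinearMap.rank (T : H →ₗ[ℂ] H) < Cardinal.aleph0}
  zero_mem' := by simpa using! Cardinal.aleph0_pos
  add_mem' {S T} hS hT :=
    (LinearMap.rank_add_le (S : H →ₗ[ℂ] H) (T : H →ₗ[ℂ] H)).trans_lt (Cardinal.add_lt_aleph0 hS hT)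
  smul_mem' c T hT := by
    have : ((c • T : H →L[ℂ] H) : H →ₗ[ℂ] H) =
        (c • LinearMap.id : H →ₗ[ℂ] H) ∘ₗ (T : H →ₗ[ℂ] H) := by
      ext; simp
    rw [Set.mem_ofPred_eq, this]
    exact (LinearMap.rank_comp_le_right _ _).trans_lt hT

omit [CompleteSpace H] in
lemma mul_mul_mem_finiteRank {T : H →L[ℂ] H} (hT : T ∈ finiteRank H) (A B : H →L[ℂ] H) :
    A * T * B ∈ finiteRank H := by
  have : ((A * T * B : H →L[ℂ] H) : H →ₗ[ℂ] H) =
      (A : H →ₗ[ℂ] H) ∘ₗ ((T : H →ₗ[ℂ] H) ∘ₗ (B : H →ₗ[ℂ] H)) := rfl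
  change LinearMap.rank ((A * T * B : H →L[ℂ] H) : H →ₗ[ℂ] H) < _
  rw [this]
  exact ((LinearMap.rank_comp_le_right _ _).trans (LinearMap.rank_comp_le_left _ _)).trans_lt hT

omit [CompleteSpace H] in
lemma exists_singVal_eq_zero {T : H →L[ℂ] H} (hT : T ∈ finiteRank H) : ∃ r, singVal T r = 0 := by
  obtain ⟨r, hr⟩ := Cardinal.lt_aleph0.1 hT
  refine ⟨r, le_antisymm ((singVal_le hr.le).trans_eq ?_) (singVal_nonneg T r)⟩
  rw [sub_self, norm_zero]

/-- The transformer of the divided difference is bounded on nuclear operators. -/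
lemma kyFanNorm_divDiff_nuclear_le {f : LaurentPolynomial ℂ} {d : ℕ} (hf : TrigDegreeLE f d)
    (hf1 : ∀ z : Circle, ‖trigVal f z‖ ≤ 1) (U V : unitary (H →L[ℂ] H)) {m : ℕ} {p q : Fin m → H}
    (hp : ∀ i, ‖p i‖ = 1) (hq : ∀ i, ‖q i‖ = 1) {σ : Fin m → ℝ} (hσ : ∀ i, 0 ≤ σ i) (l : ℕ) :
    kyFanNorm l (divDiff f U V (∑ i, (σ i : ℂ) • rankOne ℂ (q i) (p i))) ≤ d * ∑ i, σ i := by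
  set Y := divDiff f U V (∑ i, (σ i : ℂ) • rankOne ℂ (q i) (p i)) with hY
  have hYf : Y ∈ finiteRank H := divDiff_mem f U V _ fun A B => mul_mul_mem_finiteRank
    ((rank_sum_rankOne_le univ (fun i => (σ i : ℂ)) p q).trans_lt Cardinal.natCast_lt_aleph0) A B
  obtain ⟨r, hr⟩ := exists_singVal_eq_zero hYf
  refine le_of_forall_pos_le_add fun ε hε => ?_
  set ε' := ε / (l + 1) with hε'
  have hε'0 : 0 < ε' := by positivity
  -- `Y` has finite rank, so `s_r = 0` for some `r` and any positive level may be used: `Y` is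
  -- nearly a finite sum of rank one operators, with error `ε` in the Ky Fan norm.
  obtain ⟨n, e, g, s, -, he, hg, hs, hsc, hYe, hrem⟩ :=
    exists_singular_vectors Y r (c := ε') (by rw [hr]; exact hε'0)
  set Y' := ∑ i, ((s i - ε' : ℝ) : ℂ) • rankOne ℂ (g i) (e i) with hY'
  have h1 : kyFanNorm l Y ≤ ∑ i, (s i - ε') + ε := by
    have h := kyFanNorm_add_le l Y' (Y - Y')
    rw [add_sub_cancel] at h
    have h2 := kyFanNorm_sum_rankOne_le he hg (t := fun i => s i - ε')
      (fun i j hij => sub_le_sub_right (hs hij) _) (fun i => sub_nonneg.2 (hsc i)) l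
    have h3 : (l + 1 : ℝ) * ‖Y - Y'‖ ≤ ε :=
      (mul_le_mul_of_nonneg_left hrem (by positivity)).trans_eq (by rw [hε']; field_simp)
    linarith
  -- The contraction dual to `Y`: the functional `φ` is the trace against `B`, and it takes the
  -- value `∑ s j` at `Y`.
  set B : H →L[ℂ] H := ∑ j, ((1 : ℝ) : ℂ) • rankOne ℂ (e j) (g j) with hB
  have hBn : ‖B‖ ≤ 1 := norm_sum_rankOne_le hg he zero_le_one (fun _ => by simp)
  let φ : (H →L[ℂ] H) →ₗ[ℂ] ℂ :=
    { toFun := fun T => ∑ j, inner ℂ (g j) (T (e j))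
      map_add' := fun S T => by simp [sum_add_distrib]
      map_smul' := fun c T => by simp [mul_sum] }
  let ψ : Fin m → (H →L[ℂ] H) →ₗ[ℂ] ℂ := fun i =>
    { toFun := fun T => inner ℂ (p i) (T (q i))
      map_add' := fun S T => by simp
      map_smul' := fun c T => by simp }
  -- Trace duality moves the transformer from the rank one operator to `B`, with `U` and `V`
  -- exchanged, where the operator norm bound applies.
  have hswap : ∀ i, φ (divDiff f U V (rankOne ℂ (q i) (p i))) = ψ i (divDiff f V U B) := fun i =>
    divDiff_swap f U V φ (ψ i) fun A C => by
      simp only [φ, ψ, LinearMap.coe_mk, AddHom.coe_mk, mul_apply_eq_comp, rankOne_apply, hB,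
        _root_.sum_apply, _root_.smul_apply, map_sum, map_smul, inner_sum, inner_smul_right,
        Complex.ofReal_one, one_mul]
      exact sum_congr rfl fun j _ => mul_comm _ _
  have hφY : φ Y = ((∑ j, s j : ℝ) : ℂ) := by
    simp only [φ, LinearMap.coe_mk, AddHom.coe_mk, hYe, inner_smul_right]
    rw [Complex.ofReal_sum]
    refine sum_congr rfl fun j _ => ?_
    rw [inner_self_eq_norm_sq_to_K, hg.1 j]; simp
  have h4 : ∑ j, s j ≤ d * ∑ i, σ i := by
    have h5 : φ Y = ∑ i, (σ i : ℂ) * ψ i (divDiff f V U B) := by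
      rw [hY, map_sum, map_sum]
      simp only [map_smul, hswap, smul_eq_mul]
    have h6 : ∀ i, ‖ψ i (divDiff f V U B)‖ ≤ d := fun i => by
      refine (norm_inner_le_norm _ _).trans ?_
      rw [hp, one_mul]
      refine (ContinuousLinearMap.le_opNorm _ _).trans ?_
      rw [hq, mul_one]
      exact (norm_divDiff_le hf hf1 V U B).trans (mul_le_of_le_one_right (Nat.cast_nonneg d) hBn)
    calc ∑ j, s j ≤ ‖φ Y‖ := by rw [hφY, Complex.norm_real]; exact le_abs_self _
      _ ≤ ∑ i, σ i * d := by
        rw [h5]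
        refine (norm_sum_le _ _).trans (sum_le_sum fun i _ => ?_)
        rw [norm_mul, Complex.norm_real, Real.norm_eq_abs, abs_of_nonneg (hσ i)]
        exact mul_le_mul_of_nonneg_left (h6 i) (hσ i)
      _ = d * ∑ i, σ i := by rw [← sum_mul, mul_comm]
  have h7 : ∑ i, (s i - ε') ≤ ∑ i, s i := sum_le_sum fun i _ => by linarith
  linarith

/-- The transformer of the divided difference is bounded in the Ky Fan norms. -/
theorem kyFanNorm_divDiff_le {f : LaurentPolynomial ℂ} {d : ℕ} (hf : TrigDegreeLE f d)
    (hf1 : ∀ z : Circle, ‖trigVal f z‖ ≤ 1) (U V : unitary (H →L[ℂ] H)) (X : H →L[ℂ] H) (l : ℕ) :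
    kyFanNorm l (divDiff f U V X) ≤ d * kyFanNorm l X := by
  have key : ∀ ε > 0, kyFanNorm l (divDiff f U V X) ≤ d * (kyFanNorm l X + (l + 1) * ε) := by
    intro ε hε
    -- Any level strictly above `s_l` yields at most `l` singular vectors. The excess over `c` is
    -- handled by the nuclear bound and the remainder, of norm at most `c`, by the operator norm
    -- bound.
    set c := singVal X l + ε with hc
    have hc0 : 0 ≤ c := add_nonneg (singVal_nonneg X l) hε.le
    obtain ⟨n, e, g, s, hn, he, hg, hs, hsc, hXe, hrem⟩ :=
      exists_singular_vectors X l (c := c) (by linarith)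
    set X' := ∑ i, ((s i - c : ℝ) : ℂ) • rankOne ℂ (g i) (e i) with hX'
    have h1 := kyFanNorm_add_le l (divDiff f U V X') (divDiff f U V (X - X'))
    rw [← map_add, add_sub_cancel] at h1
    have h2 := kyFanNorm_divDiff_nuclear_le hf hf1 U V (p := e) (q := g) he.1 hg.1
      (σ := fun i => s i - c) (fun i => sub_nonneg.2 (hsc i)) l
    have h3 : ‖divDiff f U V (X - X')‖ ≤ d * c :=
      (norm_divDiff_le hf hf1 U V _).trans (mul_le_mul_of_nonneg_left hrem (Nat.cast_nonneg d))
    -- The two pieces recombine without loss: `∑ (s i - c) + (l + 1) c` is at most `∑ s_j(X)` over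
    -- `j ≤ l`, up to the `ε` terms, since the extra summands `s_j + ε - c` with `j ≤ l` are
    -- nonnegative.
    have h4 : ∑ i, (s i - c) + (l + 1) * c ≤ kyFanNorm l X + (l + 1) * ε := by
      have h5 : ∑ i, (s i - c) ≤ ∑ j ∈ range n, (singVal X j + ε - c) := by
        rw [← Fin.sum_univ_eq_sum_range (fun j => singVal X j + ε - c)]
        refine sum_le_sum fun i _ => ?_
        have := le_singVal_of_singular_vectors he hg hs (fun i => hc0.trans (hsc i)) hXe i
        linarith
      have h6 : ∑ j ∈ range n, (singVal X j + ε - c) ≤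
          ∑ j ∈ range (l + 1), (singVal X j + ε - c) := by
        refine sum_le_sum_of_subset_of_nonneg (range_subset_range.2 (by omega)) fun j hj _ => ?_
        have := singVal_antitone X (Nat.lt_succ_iff.1 (mem_range.1 hj))
        linarith
      have h7 : ∑ j ∈ range (l + 1), (singVal X j + ε - c) =
          kyFanNorm l X + (l + 1) * ε - (l + 1) * c := by
        rw [sum_sub_distrib, sum_add_distrib, kyFanNorm]; simp
      linarith
    have h8 : (0 : ℝ) ≤ l + 1 := by positivity
    calc kyFanNorm l (divDiff f U V X) ≤ d * ∑ i, (s i - c) + (l + 1) * (d * c) :=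
          h1.trans (add_le_add h2 (mul_le_mul_of_nonneg_left h3 h8))
      _ = d * (∑ i, (s i - c) + (l + 1) * c) := by ring
      _ ≤ _ := mul_le_mul_of_nonneg_left h4 (Nat.cast_nonneg d)
  refine le_of_forall_pos_le_add fun ε hε => ?_
  -- The factor `d + 1` instead of `d` keeps the denominator positive when `d = 0`.
  have h := key (ε / ((d + 1) * (l + 1))) (by positivity)
  refine h.trans ?_
  rw [mul_add]
  refine add_le_add le_rfl ?_
  rw [show (d : ℝ) * ((l + 1) * (ε / ((d + 1) * (l + 1)))) = ε * (d / (d + 1)) by field_simp]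
  exact mul_le_of_le_one_right hε.le (div_le_one_of_le₀ (by linarith) (by positivity))

/-- For `d > 0` and `X` in the ideal, the Ky Fan bounds say that the image of `X` is majorized by `d
• X`. -/
theorem extNorm_trigOp_commutator_le {f : LaurentPolynomial ℂ} {d : ℕ} (hf : TrigDegreeLE f d)
    (hf1 : ∀ z : Circle, ‖trigVal f z‖ ≤ 1) (U V : unitary (H →L[ℂ] H)) (I : QuasinormedIdeal H)
    (hI : I.HasMajorization) (R : H →L[ℂ] H) :
    I.extNorm (trigOp f U * R - R * trigOp f V) ≤ d * I.extNorm ((U : H →L[ℂ] H) * R - R * V) := by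
  set X := (U : H →L[ℂ] H) * R - R * V with hX
  rw [← divDiff_commutator, ← hX]
  -- For `d = 0` the right side is `0` even when `X` lies outside the ideal, so the image of `X`
  -- must be shown to vanish.
  rcases Nat.eq_zero_or_pos d with rfl | hd
  · have h0 : divDiff f U V X = 0 := by
      have := norm_divDiff_le hf hf1 U V X
      rw [Nat.cast_zero, zero_mul] at this
      exact norm_le_zero_iff.1 this
    have h1 : I.qnorm ⟨0, I.carrier.zero_mem⟩ = 0 := (I.qnorm_eq_zero_iff _).2 rfl
    rw [h0, QuasinormedIdeal.extNorm, dif_pos I.carrier.zero_mem, h1]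
    simp
  by_cases hXI : X ∈ I.carrier
  · have hd0 : (d : ℂ) ≠ 0 := by exact_mod_cast hd.ne'
    obtain ⟨h, hle⟩ := hI ((d : ℂ) • ⟨X, hXI⟩) (divDiff f U V X) fun l => by
      refine (kyFanNorm_divDiff_le hf hf1 U V X l).trans ?_
      rw [kyFanNorm, mul_sum]
      refine sum_le_sum fun j _ => ?_
      have := mul_singVal_le_singVal_smul hd0 X j
      rwa [Complex.norm_natCast] at this
    rw [I.qnorm_smul, Complex.norm_natCast] at hle
    rw [QuasinormedIdeal.extNorm, QuasinormedIdeal.extNorm, dif_pos h, dif_pos hXI,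
      ← ENNReal.ofReal_natCast d, ← ENNReal.ofReal_mul (Nat.cast_nonneg d)]
    exact ENNReal.ofReal_le_ofReal hle
  · have hd0 : (d : ℝ≥0∞) ≠ 0 := by exact_mod_cast hd.ne'
    rw [QuasinormedIdeal.extNorm, QuasinormedIdeal.extNorm, dif_neg hXI, ENNReal.mul_top hd0]
    exact le_top

end Majorization

/-! ### The scalar supremum and extremal unitaries. -/

section Sharpness

open Complex

lemma norm_circle_exp_pow_sub_one (a : ℝ) (d : ℕ) :
    ‖(Circle.exp a : ℂ) ^ d - 1‖ = 2 * |Real.sin (d * a / 2)| := by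
  rw [Circle.coe_exp, ← exp_nat_mul, show (d : ℂ) * (a * I) = I * ((d * a : ℝ) : ℂ) by
    push_cast; ring, norm_exp_I_mul_ofReal_sub_one, norm_mul, Real.norm_eq_abs, Real.norm_eq_abs,
    abs_two]

lemma norm_circle_exp_sub_one (a : ℝ) : ‖(Circle.exp a : ℂ) - 1‖ = 2 * |Real.sin (a / 2)| := by
  simpa using norm_circle_exp_pow_sub_one a 1

lemma norm_circle_exp_sub_one_of_nonneg {a : ℝ} (h0 : 0 ≤ a) (hpi : a ≤ Real.pi) :
    ‖(Circle.exp a : ℂ) - 1‖ = 2 * Real.sin (a / 2) := by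
  rw [norm_circle_exp_sub_one, abs_of_nonneg]
  exact Real.sin_nonneg_of_nonneg_of_le_pi (by positivity) (by linarith)

lemma norm_circle_exp_pow_sub_one_le {a θ : ℝ} (h : |a| ≤ θ) (d : ℕ) :
    ‖(Circle.exp a : ℂ) ^ d - 1‖ ≤ bernsteinBeta d θ := by
  rw [norm_circle_exp_pow_sub_one, bernsteinBeta]
  split_ifs with hθ
  · refine mul_le_mul_of_nonneg_left ?_ two_pos.le
    have h1 : (d : ℝ) * |a| ≤ d * θ := mul_le_mul_of_nonneg_left h (Nat.cast_nonneg d)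
    have h0 : 0 ≤ (d : ℝ) * |a| := by positivity
    have h2 : |Real.sin (d * a / 2)| = Real.sin (d * |a| / 2) := by
      rw [Real.abs_sin_eq_sin_abs_of_abs_le_pi, abs_div, abs_mul, Nat.abs_cast, abs_two]
      rw [abs_div, abs_mul, Nat.abs_cast, abs_two]
      linarith
    rw [h2]
    exact Real.sin_le_sin_of_le_of_le_pi_div_two (by linarith [Real.pi_pos]) (by linarith)
      (by linarith)
  · linarith [Real.abs_sin_le_one (d * a / 2)]

/-- Rotation invariance reduces a pair of points to the single angle `arg (z / w)`. -/
lemma norm_circle_pow_sub_pow (z w : Circle) (d : ℕ) :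
    ‖(z : ℂ) ^ d - (w : ℂ) ^ d‖ = ‖(Circle.exp (arg (z / w)) : ℂ) ^ d - 1‖ := by
  have h : (Circle.exp (arg (z / w)) : ℂ) = z / w := by
    rw [← Circle.coe_div, Circle.exp_arg]
  have hw : (w : ℂ) ^ d ≠ 0 := pow_ne_zero _ (Circle.coe_ne_zero w)
  rw [h, div_pow, ← div_self hw, ← sub_div, norm_div, norm_pow, Circle.norm_coe, one_pow, div_one]

theorem isLUB_norm_pow_sub_pow (d : ℕ) {δ : ℝ} (h0 : 0 < δ) (h2 : δ ≤ 2) :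
    IsLUB {x : ℝ | ∃ z w : Circle, ‖(z : ℂ) - w‖ < δ ∧ x = ‖(z : ℂ) ^ d - (w : ℂ) ^ d‖}
      (bernsteinBeta d (2 * Real.arcsin (δ / 2))) := by
  have hpi := Real.pi_pos
  set θ := 2 * Real.arcsin (δ / 2) with hθ
  have hθ0 : 0 < θ := by
    have : 0 < Real.arcsin (δ / 2) := Real.arcsin_pos.2 (by positivity)
    positivity
  have hθpi : θ ≤ Real.pi := by linarith [Real.arcsin_le_pi_div_two (δ / 2)]
  have hlt : ∀ a : ℝ, 0 ≤ a → a ≤ Real.pi → (2 * Real.sin (a / 2) < δ ↔ a < θ) := by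
    intro a ha ha'
    have := Real.lt_arcsin_iff_sin_lt (x := a / 2) (y := δ / 2) ⟨by linarith, by linarith⟩
      ⟨by linarith, by linarith⟩
    rw [hθ, ← div_lt_iff₀' two_pos, this, lt_div_iff₀' two_pos]
  constructor
  · rintro _ ⟨z, w, hzw, rfl⟩
    rw [norm_circle_pow_sub_pow]
    refine norm_circle_exp_pow_sub_one_le (le_of_lt ?_) d
    have h := norm_circle_pow_sub_pow z w 1
    rw [pow_one, pow_one, pow_one, norm_circle_exp_sub_one] at h
    rw [h] at hzw
    refine (hlt _ (abs_nonneg _) (abs_arg_le_pi _)).1 ?_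
    rwa [Real.abs_sin_eq_sin_abs_of_abs_le_pi, abs_div, abs_two] at hzw
    rw [abs_div, abs_two]
    linarith [abs_arg_le_pi ((z : ℂ) / w)]
  · intro b hb
    have hmem : ∀ a : ℝ, 0 ≤ a → a < θ → 2 * Real.sin (d * a / 2) ≤ b := by
      intro a ha haθ
      refine le_trans ?_ (hb ⟨Circle.exp a, 1, ?_, rfl⟩)
      · rw [Circle.coe_one, one_pow, norm_circle_exp_pow_sub_one]
        exact mul_le_mul_of_nonneg_left (le_abs_self _) two_pos.le
      · rw [Circle.coe_one, norm_circle_exp_sub_one_of_nonneg ha (by linarith)]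
        exact (hlt a ha (by linarith)).2 haθ
    rw [bernsteinBeta]
    split_ifs with h
    -- The constraint `a < θ` is strict, so the value at `θ` is reached only as a left limit.
    · have hcont : Filter.Tendsto (fun a : ℝ => 2 * Real.sin (d * a / 2)) (𝓝[<] θ)
          (𝓝 (2 * Real.sin (d * θ / 2))) :=
        (Continuous.tendsto (by fun_prop) θ).mono_left nhdsWithin_le_nhds
      refine le_of_tendsto hcont ?_
      filter_upwards [Ioo_mem_nhdsLT hθ0] with a ha
      exact hmem a ha.1.le ha.2
    · have hd : (0 : ℝ) < d := by
        by_contra hd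
        rw [le_antisymm (not_lt.1 hd) (Nat.cast_nonneg d), zero_mul] at h
        exact h hpi.le
      -- For `d θ > π` the angle `π / d` lies strictly below `θ` and makes the `d`-th powers
      -- antipodal.
      have := hmem (Real.pi / d) (by positivity) ((div_lt_iff₀' hd).2 (not_le.1 h))
      rwa [mul_div_cancel₀ _ hd.ne', Real.sin_pi_div_two, mul_one] at this

lemma norm_diagUnitary_scalar_sub_one {ι : Type*} [Fintype ι] {z : ι → Circle} {C : ℝ}
    (h : ∀ i, ‖(z i : ℂ) - 1‖ ≤ C) (i₀ : ι) (h₀ : ‖(z i₀ : ℂ) - 1‖ = C) :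
    ‖((diagUnitary fun i => (scalarUnitary (z i) : unitary (ℂ →L[ℂ] ℂ)) :
      unitary (PiLp 2 (fun _ : ι => ℂ) →L[ℂ] PiLp 2 (fun _ : ι => ℂ))) :
      PiLp 2 (fun _ : ι => ℂ) →L[ℂ] PiLp 2 (fun _ : ι => ℂ)) - 1‖ = C := by
  classical
  have hC : 0 ≤ C := (norm_nonneg _).trans (h i₀)
  have happ : ∀ (x : PiLp 2 (fun _ : ι => ℂ)) (i : ι),
      (((diagUnitary fun i => (scalarUnitary (z i) : unitary (ℂ →L[ℂ] ℂ)) :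
      unitary (PiLp 2 (fun _ : ι => ℂ) →L[ℂ] PiLp 2 (fun _ : ι => ℂ))) :
      PiLp 2 (fun _ : ι => ℂ) →L[ℂ] PiLp 2 (fun _ : ι => ℂ)) - 1) x i =
      ((z i : ℂ) - 1) * x i := fun x i => by
    rw [_root_.sub_apply, PiLp.sub_apply, diagUnitary_apply, coe_scalarUnitary, sub_mul, one_mul]
    rfl
  refine le_antisymm (ContinuousLinearMap.opNorm_le_bound _ hC fun x => ?_) ?_
  · refine le_of_sq_le_sq ?_ (by positivity)
    rw [PiLp.norm_sq_eq_of_L2, mul_pow, PiLp.norm_sq_eq_of_L2, Finset.mul_sum]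
    refine Finset.sum_le_sum fun i _ => ?_
    rw [happ, norm_mul, mul_pow]
    exact mul_le_mul_of_nonneg_right (pow_le_pow_left₀ (norm_nonneg _) (h i) 2) (sq_nonneg _)
  · set x : PiLp 2 (fun _ : ι => ℂ) := blockSingle i₀ (1 : ℂ) with hx
    have hx1 : ‖x‖ = 1 := by rw [hx, norm_blockSingle_apply, norm_one]
    have h1 := (PiLp.norm_apply_le _ i₀).trans (ContinuousLinearMap.le_opNorm
      (((diagUnitary fun i => (scalarUnitary (z i) : unitary (ℂ →L[ℂ] ℂ)) :
      unitary (PiLp 2 (fun _ : ι => ℂ) →L[ℂ] PiLp 2 (fun _ : ι => ℂ))) :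
      PiLp 2 (fun _ : ι => ℂ) →L[ℂ] PiLp 2 (fun _ : ι => ℂ)) - 1) x)
    rw [happ, hx1, mul_one, hx, blockSingle_apply, if_pos rfl, mul_one, h₀] at h1
    exact h1

/-- Two diagonal entries are needed: one realizes the distance `δ`, the other the maximal distance
of the `d`-th powers, which for `d θ > π` is attained at the smaller angle `π / d`. -/
theorem exists_unitary_sharp (d : ℕ) {δ : ℝ} (h0 : 0 ≤ δ) (h2 : δ ≤ 2) :
    ∃ U V : unitary (EuclideanSpace ℂ (Fin 2) →L[ℂ] EuclideanSpace ℂ (Fin 2)),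
      ‖(U : EuclideanSpace ℂ (Fin 2) →L[ℂ] EuclideanSpace ℂ (Fin 2)) - V‖ = δ ∧
      ‖trigOp (LaurentPolynomial.T d) U - trigOp (LaurentPolynomial.T d) V‖ =
        bernsteinBeta d (2 * Real.arcsin (δ / 2)) := by
  have hpi := Real.pi_pos
  have hT : ∀ U : unitary (EuclideanSpace ℂ (Fin 2) →L[ℂ] EuclideanSpace ℂ (Fin 2)),
      trigOp (LaurentPolynomial.T d) U =
        ((U ^ d : unitary (EuclideanSpace ℂ (Fin 2) →L[ℂ] EuclideanSpace ℂ (Fin 2))) :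
          EuclideanSpace ℂ (Fin 2) →L[ℂ] EuclideanSpace ℂ (Fin 2)) := fun U => by
    rw [trigOp, LaurentPolynomial.smeval_T_pow, zpow_natCast, ← map_pow]; rfl
  set θ := 2 * Real.arcsin (δ / 2) with hθ
  have hθ0 : 0 ≤ θ := mul_nonneg two_pos.le (Real.arcsin_nonneg.2 (by positivity))
  have hθpi : θ ≤ Real.pi := by linarith [Real.arcsin_le_pi_div_two (δ / 2)]
  have hsin : 2 * Real.sin (θ / 2) = δ := by
    rw [hθ, mul_div_cancel_left₀ _ (two_ne_zero), Real.sin_arcsin (by linarith) (by linarith)]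
    ring
  obtain ⟨b, hb0, hbθ, hb⟩ : ∃ b, 0 ≤ b ∧ b ≤ θ ∧
      ‖(Circle.exp b : ℂ) ^ d - 1‖ = bernsteinBeta d θ := by
    by_cases h : (d : ℝ) * θ ≤ Real.pi
    · refine ⟨θ, hθ0, le_rfl, ?_⟩
      rw [norm_circle_exp_pow_sub_one, bernsteinBeta, if_pos h, abs_of_nonneg]
      exact Real.sin_nonneg_of_nonneg_of_le_pi (by positivity) (by linarith)
    · have hd : (0 : ℝ) < d := by
        by_contra hd
        rw [le_antisymm (not_lt.1 hd) (Nat.cast_nonneg d), zero_mul] at h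
        exact h hpi.le
      refine ⟨Real.pi / d, by positivity, (div_le_iff₀' hd).2 (not_le.1 h).le, ?_⟩
      rw [norm_circle_exp_pow_sub_one, bernsteinBeta, if_neg h, mul_div_cancel₀ _ hd.ne',
        Real.sin_pi_div_two, abs_one, mul_one]
  let z : Fin 2 → Circle := ![Circle.exp θ, Circle.exp b]
  refine ⟨diagUnitary fun i => scalarUnitary (z i), 1, ?_, ?_⟩
  · refine norm_diagUnitary_scalar_sub_one (fun i => ?_) 0 ?_
    · fin_cases i
      · exact (norm_circle_exp_sub_one_of_nonneg hθ0 hθpi).le.trans hsin.le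
      · refine (norm_circle_exp_sub_one_of_nonneg hb0 (hbθ.trans hθpi)).le.trans ?_
        rw [← hsin]
        exact mul_le_mul_of_nonneg_left (Real.sin_le_sin_of_le_of_le_pi_div_two (by linarith)
          (by linarith) (by linarith)) two_pos.le
    · exact (norm_circle_exp_sub_one_of_nonneg hθ0 hθpi).trans hsin
  · rw [hT, hT, one_pow, ← map_pow, show ((fun i => scalarUnitary (z i)) ^ d :
      Fin 2 → unitary (ℂ →L[ℂ] ℂ)) = fun i => scalarUnitary (z i ^ d) by
        funext i; rw [Pi.pow_apply, map_pow]]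
    refine norm_diagUnitary_scalar_sub_one (fun i => ?_) 1 ?_
    · rw [Circle.coe_pow]
      fin_cases i
      · exact norm_circle_exp_pow_sub_one_le (abs_of_nonneg hθ0).le d
      · exact hb.le
    · rw [Circle.coe_pow]; exact hb

end Sharpness

end

theorem mainTheorem3 (d : ℕ) :
    (∀ f : LaurentPolynomial ℂ, TrigDegreeLE f d → (∀ z : Circle, ‖trigVal f z‖ ≤ 1) →
      ∀ (H : Type u) [NormedAddCommGroup H] [InnerProductSpace ℂ H] [CompleteSpace H]
        (U V : unitary (H →L[ℂ] H)),
        ‖trigOp f U - trigOp f V‖ ≤ d * ‖(U : H →L[ℂ] H) - V‖ ∧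
        ‖trigOp f U - trigOp f V‖ ≤
          bernsteinBeta d (2 * Real.arcsin (‖(U : H →L[ℂ] H) - V‖ / 2)) ∧
        (∀ R : H →L[ℂ] H,
          ‖trigOp f U * R - R * trigOp f V‖ ≤ d * ‖(U : H →L[ℂ] H) * R - R * V‖) ∧
        (∀ I : QuasinormedIdeal H, I.HasMajorization → ∀ R : H →L[ℂ] H,
          I.extNorm (trigOp f U * R - R * trigOp f V) ≤
            d * I.extNorm ((U : H →L[ℂ] H) * R - R * V))) ∧
    (∀ δ : ℝ, 0 < δ → δ ≤ 2 →
      IsLUB {x : ℝ | ∃ z w : Circle, ‖(z : ℂ) - w‖ < δ ∧ x = ‖(z : ℂ) ^ d - (w : ℂ) ^ d‖}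
        (bernsteinBeta d (2 * Real.arcsin (δ / 2)))) ∧
    (∀ δ : ℝ, 0 ≤ δ → δ ≤ 2 →
      ∃ U V : unitary (EuclideanSpace ℂ (Fin 2) →L[ℂ] EuclideanSpace ℂ (Fin 2)),
        ‖(U : EuclideanSpace ℂ (Fin 2) →L[ℂ] EuclideanSpace ℂ (Fin 2)) - V‖ = δ ∧
        ‖trigOp (LaurentPolynomial.T d) U - trigOp (LaurentPolynomial.T d) V‖ =
          bernsteinBeta d (2 * Real.arcsin (δ / 2))) := by
  refine ⟨fun f hf hf1 H _ _ _ U V => ⟨norm_trigOp_sub_le hf hf1 U V,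
    norm_trigOp_sub_le_bernsteinBeta hf hf1 U V, norm_trigOp_commutator_le hf hf1 U V,
    extNorm_trigOp_commutator_le hf hf1 U V⟩, fun δ h0 h2 => isLUB_norm_pow_sub_pow d h0 h2,
    fun δ h0 h2 => exists_unitary_sharp d h0 h2⟩
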